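/- Let $d\ge 2$. There is a finite constant $C=C(d)$, depending only on $d$, such that the following holds. Let $(a,b)\subset\mathbb R$ be a nonempty open interval, with $-\infty\le a<b\le\infty$, and let $\phi\in C^{d+2}(a,b)$ be a real-valued function with $\phi^{(j)}(t)>0$ for all $t\in(a,b)$ and $j=0,1,\dots,d+2$. Put $$\gamma(t)=\Big(t,\frac{t^2}{2},\dots,\frac{t^{d-1}}{(d-1)!},\phi(t)\Big)\in\mathbb R^d,\qquad \omega(t)=\phi^{(d)}(t)\qquad (a<t<b).$$ Then for every Borel set $F\subset\mathbb R^d$, with characteristic function $\chi_F$ and Lebesgue measure $m_d(F)\in[0,\infty]$, $$\int_a^b\Big(\int_{\{t_1\le t_i<b,\ 2\le i\le d\}}\chi_F\big(\gamma(t_1)+\cdots+\gamma(t_d)\big)\Big[\prod_{i=2}^d\omega(t_i)\Big]^{2/(d^2+d)}dt_2\cdots dt_d\Big)^{(d+2)/2}\omega(t_1)^{2/(d^2+d)}\,dt_1\ \le\ C(d)\,m_d(F).$$ -/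

import Mathlib

open MeasureTheory
open scoped NNReal ENNReal

/-- The open interval `(a, b)` of real numbers; the endpoints may be infinite. -/
def openInterval (a b : EReal) : Set ℝ := {t : ℝ | a < (t : EReal) ∧ (t : EReal) < b}

/-- The hypotheses on the function `φ` that generates a simple curve in `ℝ^d`:
`φ` is of class `C^(d+2)` on the open interval `(a, b)`, and `φ, φ', …, φ^(d+2)` are
strictly positive there. As `(a, b)` is open, `iteratedDeriv` at its points does not see the values
of `φ` outside it. -/
structure IsSimpleOn (d : ℕ) (φ : ℝ → ℝ) (a b : EReal) : Prop where
  contDiffOn : ContDiffOn ℝ (d + 2 : ℕ) φ (openInterval a b)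
  iteratedDeriv_pos : ∀ j ≤ d + 2, ∀ t ∈ openInterval a b, 0 < iteratedDeriv j φ t

/-- The curve `γ(t) = (t, t²/2, …, t^(d-1)/(d-1)!, φ(t))` in `ℝ^d`. -/
noncomputable def simpleCurve (d : ℕ) (φ : ℝ → ℝ) (t : ℝ) : Fin d → ℝ :=
  fun i => if (i : ℕ) + 1 < d then t ^ ((i : ℕ) + 1) / (Nat.factorial ((i : ℕ) + 1) : ℝ) else φ t

/-- The weight `ω = φ^(d)`. -/
noncomputable def curveWeight (d : ℕ) (φ : ℝ → ℝ) (t : ℝ) : ℝ := iteratedDeriv d φ t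

/-- The inner integral: the integral of
`χ_F(γ(t₁) + γ(t₂) + ⋯ + γ(t_d)) (∏_{i=2}^d ω(t_i))^(2/(d²+d))` over all `(t₂, …, t_d)` with
`t₁ ≤ t_i < b` for each `i`. The `d - 1` variables `t₂, …, t_d` are the coordinates of `s`. -/
noncomputable def innerIntegral (d : ℕ) (φ : ℝ → ℝ) (b : EReal) (F : Set (Fin d → ℝ)) (t₁ : ℝ) :
    ℝ≥0∞ :=
  ∫⁻ s in {s : Fin (d - 1) → ℝ | ∀ i, t₁ ≤ s i ∧ (s i : EReal) < b},
    F.indicator (fun _ => (1 : ℝ≥0∞)) (simpleCurve d φ t₁ + ∑ i, simpleCurve d φ (s i)) *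
      ENNReal.ofReal ((∏ i, curveWeight d φ (s i)) ^ (2 / ((d : ℝ) ^ 2 + (d : ℝ))))

/-! Put `n = d - 1`, `δ = 2/(d²+d)`, and let `J` be the Jacobian of `(t₁, …, t_d) ↦ γ(t₁) + ⋯ +
γ(t_d)`. This map is injective on increasing tuples (`injOn_sum_curve`) and `J > 0` there, so the
integral of `J χ_F` over them is at most the measure of `F`. Sorting `t₂, …, t_d` costs a factorial.
It remains to show, on each fibre `t₁ = s` and for every set `E` of increasing tuples, that `(∫_E
W)^((d+2)/2) ω(s)^δ ≤ C ∫_E J`, where `W = ∏ ω(t_i)^δ`. Splitting `E` at a level of `J/W` and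
optimising the level reduces this to a bound for the integral of `W` over `{J ≤ e^L W}`
(`lintegral_weight_sublevel_le`).

The crux is a lower bound for `J` that retains the growth of `ω`. As a function of the last entry,
`J` is an interpolation error; if `ω ≥ m` to the right of `p`, then `J ≥ c m V ∏ (t_d - max(t_i,
p))`, with `V` the Vandermonde determinant of the other entries (`det_curveJacobian_lower_bound`).
The thresholds `p` are points where `ω = 2^k ω(s)`, one for `s` and one for the dyadic level of each
later entry. A weighted geometric mean of the resulting `d` bounds treats all gaps alike and leaves
a surplus (`averaged_log_bound`). On the sublevel set this surplus bounds `W` by a product of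
integrable kernels in consecutive variables (`exists_log_weight_bound`), which are integrated one at
a time. -/

/-! ### Lower bounds for interpolation errors -/

/-- The numerators of the derivatives of `x ↦ K 0 x / (x - c)`, when `K k` is the `k`-th derivative
of `K 0`. -/
noncomputable def divNum (c : ℝ) (K : ℕ → ℝ → ℝ) : ℕ → ℝ → ℝ
  | 0 => K 0
  | k + 1 => fun x => (x - c) ^ (k + 1) * K (k + 1) x - (k + 1) * divNum c K k x

/-- The lower-order terms cancel, so bounds on `K (k + 1)` pass to `divNum` by monotonicity alone.
-/
theorem hasDerivAt_divNum (c : ℝ) (K : ℕ → ℝ → ℝ) (x : ℝ) :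
    ∀ k : ℕ, (∀ j ≤ k, HasDerivAt (K j) (K (j + 1) x) x) →
      HasDerivAt (divNum c K k) ((x - c) ^ k * K (k + 1) x) x
  | 0, h => by simpa [divNum] using h 0 le_rfl
  | k + 1, h => by
    have h1 := hasDerivAt_divNum c K x k fun j hj => h j (by omega)
    have h2 : HasDerivAt (fun y : ℝ => (y - c) ^ (k + 1)) (((k + 1 : ℕ) : ℝ) * (x - c) ^ k * 1) x := by
      simpa using ((hasDerivAt_id x).sub_const c).fun_pow (k + 1)
    have h3 := (h2.mul (h (k + 1) le_rfl)).sub (h1.const_mul ((k : ℝ) + 1))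
    refine (h3.congr_deriv ?_)
    push_cast
    ring

theorem divNum_self (c : ℝ) (K : ℕ → ℝ → ℝ) (h : K 0 c = 0) : ∀ k : ℕ, divNum c K k c = 0
  | 0 => by simpa [divNum] using h
  | k + 1 => by simp [divNum, divNum_self c K h k]

theorem hasDerivAt_divNum_div (c : ℝ) (K : ℕ → ℝ → ℝ) {x : ℝ} (hx : x ≠ c) (k : ℕ)
    (h : ∀ j ≤ k, HasDerivAt (K j) (K (j + 1) x) x) :
    HasDerivAt (fun y => divNum c K k y / (y - c) ^ (k + 1))
      (divNum c K (k + 1) x / (x - c) ^ (k + 2)) x := by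
  have hx' : x - c ≠ 0 := sub_ne_zero.2 hx
  have h2 : HasDerivAt (fun y : ℝ => (y - c) ^ (k + 1)) (((k + 1 : ℕ) : ℝ) * (x - c) ^ k * 1) x := by
    simpa using ((hasDerivAt_id x).sub_const c).fun_pow (k + 1)
  refine ((hasDerivAt_divNum c K x k h).div h2 (pow_ne_zero _ hx')).congr_deriv ?_
  simp only [divNum]
  field_simp
  push_cast
  ring

/-- Monotonicity plays the role of integrating `m (y - c)^n` from `q` to `x`; the factored form
follows from `(q - c)^(n+1) ≤ (x - c)^n (q - c)`. -/
theorem divNum_lower_bound {c q T m : ℝ} {K : ℕ → ℝ → ℝ} {n : ℕ} (hcq : c ≤ q) (hm : 0 ≤ m)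
    (hK : ∀ k ≤ n, ∀ x ∈ Set.Icc c T, HasDerivAt (K k) (K (k + 1) x) x)
    (hc : K 0 c = 0) (hpos : ∀ x ∈ Set.Icc c T, 0 ≤ K (n + 1) x)
    (hlow : ∀ x ∈ Set.Icc q T, m ≤ K (n + 1) x) :
    (∀ x ∈ Set.Icc c T, 0 ≤ divNum c K n x) ∧
      ∀ x ∈ Set.Icc q T, m / (n + 1) * ((x - c) ^ n * (x - q)) ≤ divNum c K n x := by
  have hd : ∀ x ∈ Set.Icc c T, HasDerivAt (divNum c K n) ((x - c) ^ n * K (n + 1) x) x :=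
    fun x hx => hasDerivAt_divNum c K x n fun j hj => hK j hj x hx
  have hmono : MonotoneOn (divNum c K n) (Set.Icc c T) := by
    refine monotoneOn_of_deriv_nonneg (convex_Icc c T)
      (fun x hx => (hd x hx).continuousAt.continuousWithinAt)
      (fun x hx => (hd x (interior_subset hx)).differentiableAt.differentiableWithinAt)
      fun x hx => ?_
    have hx' := interior_subset hx
    rw [(hd x hx').deriv]
    exact mul_nonneg (pow_nonneg (sub_nonneg.2 hx'.1) _) (hpos x hx')
  have h0 : ∀ x ∈ Set.Icc c T, 0 ≤ divNum c K n x := by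
    intro x hx
    rw [← divNum_self c K hc n]
    exact hmono ⟨le_rfl, hx.1.trans hx.2⟩ hx hx.1
  refine ⟨h0, fun x hx => ?_⟩
  have hsub : Set.Icc q T ⊆ Set.Icc c T := Set.Icc_subset_Icc_left hcq
  have hd2 : ∀ x ∈ Set.Icc q T, HasDerivAt
      (fun y => divNum c K n y - m / (n + 1) * (y - c) ^ (n + 1))
      ((x - c) ^ n * K (n + 1) x - m / (n + 1) * (((n + 1 : ℕ) : ℝ) * (x - c) ^ n * 1)) x := by
    intro x hx
    refine (hd x (hsub hx)).sub (HasDerivAt.const_mul _ ?_)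
    simpa using ((hasDerivAt_id x).sub_const c).fun_pow (n + 1)
  have hmono2 : MonotoneOn (fun y => divNum c K n y - m / (n + 1) * (y - c) ^ (n + 1))
      (Set.Icc q T) := by
    refine monotoneOn_of_deriv_nonneg (convex_Icc q T)
      (fun x hx => (hd2 x hx).continuousAt.continuousWithinAt)
      (fun x hx => (hd2 x (interior_subset hx)).differentiableAt.differentiableWithinAt)
      fun x hx => ?_
    have hx' := interior_subset hx
    rw [(hd2 x hx').deriv]
    have h1 : m / (n + 1) * (((n + 1 : ℕ) : ℝ) * (x - c) ^ n * 1) = (x - c) ^ n * m := by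
      push_cast
      field_simp
    rw [h1, ← mul_sub]
    exact mul_nonneg (pow_nonneg (sub_nonneg.2 (hsub hx').1) _) (sub_nonneg.2 (hlow x hx'))
  have h2 := hmono2 ⟨le_rfl, hx.1.trans hx.2⟩ hx hx.1
  have h3 := h0 q (hsub ⟨le_rfl, hx.1.trans hx.2⟩)
  have h4 : (q - c) ^ (n + 1) ≤ (x - c) ^ n * (q - c) := by
    rw [pow_succ]
    exact mul_le_mul_of_nonneg_right
      (pow_le_pow_left₀ (sub_nonneg.2 hcq) (by linarith [hx.1]) n) (sub_nonneg.2 hcq)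
  have h5 : m / (n + 1) * (q - c) ^ (n + 1) ≤ m / (n + 1) * ((x - c) ^ n * (q - c)) :=
    mul_le_mul_of_nonneg_left h4 (by positivity)
  have h6 : m / (n + 1) * ((x - c) ^ n * (x - q)) =
      m / (n + 1) * (x - c) ^ (n + 1) - m / (n + 1) * ((x - c) ^ n * (q - c)) := by ring
  simp only at h2
  linarith

/-- A lower bound for the error of interpolation at `n` nodes, beyond the last node, in terms of a
lower bound `m` for the `n`-th derivative to the right of `p`. -/
theorem interp_error_lower_bound (n : ℕ) : ∃ c : ℝ, 0 < c ∧
    ∀ (K : ℕ → ℝ → ℝ) (α T p m : ℝ) (t : Fin n → ℝ), 0 ≤ m → p < T → α < T →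
      (∀ i, α < t i) → StrictMono t → (∀ i, t i < T) →
      (∀ k < n, ∀ x ∈ Set.Ioc α T, HasDerivAt (K k) (K (k + 1) x) x) →
      (∀ x ∈ Set.Ioc α T, 0 ≤ K n x) → (∀ x ∈ Set.Ioc α T, p ≤ x → m ≤ K n x) →
      (∀ i, K 0 (t i) = 0) → c * m * ∏ i, (T - max (t i) p) ≤ K 0 T := by
  induction n with
  | zero =>
    refine ⟨1, one_pos, fun K α T p m t _ hp hα _ _ _ _ _ hlow _ => ?_⟩
    simpa using hlow T ⟨hα, le_rfl⟩ hp.le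
  | succ n ih =>
    obtain ⟨c, hc, ih⟩ := ih
    refine ⟨c / (2 ^ (n + 1) * (n + 1)), by positivity,
      fun K α T p m t hm hp hα hαt ht htT hK hpos hlow hz => ?_⟩
    -- The induction divides out the zero at the first node. The quotient vanishes at the remaining
    -- nodes and is differentiated only to the right of `s`, which becomes the new `α`.
    set s := t 0 with hs
    set q := max s p with hq
    have hsq : s ≤ q := le_max_left _ _
    have hqT : q < T := max_lt (htT 0) hp
    have hsT : s < T := htT 0
    have hsub : Set.Icc s T ⊆ Set.Ioc α T := fun x hx => ⟨(hαt 0).trans_le hx.1, hx.2⟩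
    obtain ⟨hG0, hG1⟩ := divNum_lower_bound (c := s) (q := q) (T := T) (K := K) (n := n) hsq hm
      (fun k hk x hx => hK k (by omega) x (hsub hx)) (hz 0) (fun x hx => hpos x (hsub hx))
      (fun x hx => hlow x (hsub ⟨hsq.trans hx.1, hx.2⟩) ((le_max_right _ _).trans hx.1))
    -- Beyond the midpoint of `[q, T]` one has `(x - q)/(x - s) ≥ (T - q)/(2(T - s))`, so the
    -- quotient satisfies the hypotheses with threshold `(q + T)/2` and bound `m'`.
    set m' := m / (n + 1) * ((T - q) / (2 * (T - s))) with hm'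
    have hTq : 0 < T - q := sub_pos.2 hqT
    have hTs : 0 < T - s := sub_pos.2 hsT
    have key := ih (fun k x => divNum s K k x / (x - s) ^ (k + 1)) s T ((q + T) / 2) m'
      (fun i => t i.succ) (by positivity) (by linarith) hsT (fun i => ht (Fin.succ_pos i))
      (fun i j hij => ht (Fin.succ_lt_succ_iff.2 hij)) (fun i => htT _)
      (fun k hk x hx => hasDerivAt_divNum_div s K hx.1.ne' k
        fun j hj => hK j (by omega) x (hsub ⟨hx.1.le, hx.2⟩))
      (fun x hx => div_nonneg (hG0 x ⟨hx.1.le, hx.2⟩) (pow_nonneg (sub_nonneg.2 hx.1.le) _))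
      (fun x hx hpx => by
        have hxs : 0 < x - s := sub_pos.2 hx.1
        have hqx : q ≤ x := by linarith
        have h1 := hG1 x ⟨hqx, hx.2⟩
        rw [le_div_iff₀ (pow_pos hxs _)]
        refine le_trans ?_ h1
        have h2 : (T - q) / (2 * (T - s)) * (x - s) ≤ x - q := by
          rw [div_mul_eq_mul_div, div_le_iff₀ (by positivity)]
          nlinarith [hx.2]
        calc m' * (x - s) ^ (n + 1)
            = m / (n + 1) * ((x - s) ^ n * ((T - q) / (2 * (T - s)) * (x - s))) := by
              rw [hm', pow_succ]; ring
          _ ≤ m / (n + 1) * ((x - s) ^ n * (x - q)) := by gcongr)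
      (fun i => by simp [divNum, hz])
    simp only [divNum, zero_add, pow_one] at key
    rw [le_div_iff₀ hTs] at key
    refine le_trans ?_ key
    rw [Fin.prod_univ_succ]
    -- Moving the threshold to the midpoint at most halves each factor; with the `2` in `m'` this
    -- accounts for `2 ^ (n + 1)`.
    have h1 : ∏ i : Fin n, ((T - max (t i.succ) p) / 2) ≤
        ∏ i : Fin n, (T - max (t i.succ) ((q + T) / 2)) := by
      refine Finset.prod_le_prod (fun i _ => ?_) fun i _ => ?_
      · have := max_lt (htT i.succ) hp
        linarith
      · have h2 : s < t i.succ := ht (Fin.succ_pos i)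
        have h3 := htT i.succ
        rcases le_total (t i.succ) p with h | h
        · rw [max_eq_right h]
          have h4 : q = p := max_eq_right (h2.le.trans h)
          rw [h4, max_eq_right (by linarith)]
          linarith
        · rw [max_eq_left h]
          have h4 : q ≤ t i.succ := max_le h2.le h
          have : max (t i.succ) ((q + T) / 2) ≤ (t i.succ + T) / 2 := max_le (by linarith) (by linarith)
          linarith
    rw [Finset.prod_div_distrib, Finset.prod_const, Finset.card_univ, Fintype.card_fin,
      div_le_iff₀ (by positivity)] at h1
    have h5 : c * m' * (T - s) = c * m / (n + 1) * (T - q) / 2 := by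
      rw [hm']; field_simp
    calc c / (2 ^ (n + 1) * (n + 1)) * m * ((T - q) * ∏ i : Fin n, (T - max (t i.succ) p))
        ≤ c / (2 ^ (n + 1) * (n + 1)) * m * ((T - q) *
          ((∏ i : Fin n, (T - max (t i.succ) ((q + T) / 2))) * 2 ^ n)) := by gcongr
      _ = c * m' * (T - s) * ∏ i : Fin n, (T - max (t i.succ) ((q + T) / 2)) := by
          rw [h5, pow_succ]; field_simp
      _ = _ := by ring

/-! ### The Jacobian: derivatives, lower bound and sign -/

/-- The `k`-th derivative at `x` of the curve `(x, x²/2, …, xⁿ/n!, f 0 x)`, when `f k` is the `k`-th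
derivative of `f 0`. -/
noncomputable def curveDeriv (n : ℕ) (f : ℕ → ℝ → ℝ) (k : ℕ) (x : ℝ) : Fin (n + 1) → ℝ :=
  fun i => if (i : ℕ) + 1 < n + 1 then
    (if k ≤ (i : ℕ) + 1 then x ^ ((i : ℕ) + 1 - k) / (Nat.factorial ((i : ℕ) + 1 - k) : ℝ) else 0)
    else f k x

/-- The Jacobian matrix of `t ↦ ∑ j, γ (t j)`. -/
noncomputable def curveJacobian (n : ℕ) (f : ℕ → ℝ → ℝ) (t : Fin (n + 1) → ℝ) :
    Matrix (Fin (n + 1)) (Fin (n + 1)) ℝ :=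
  Matrix.of fun i j => curveDeriv n f 1 (t j) i

/-- `f 0, …, f (n + 1)` are successive derivatives on the open interval `I`, and the last one is
positive and strictly increasing there. -/
structure IsDerivChain (n : ℕ) (f : ℕ → ℝ → ℝ) (I : Set ℝ) : Prop where
  isOpen : IsOpen I
  ordConnected : I.OrdConnected
  hasDerivAt : ∀ k ≤ n, ∀ x ∈ I, HasDerivAt (f k) (f (k + 1) x) x
  pos : ∀ x ∈ I, 0 < f (n + 1) x
  continuousOn : ContinuousOn (f (n + 1)) I
  strictMonoOn : StrictMonoOn (f (n + 1)) I
  measurable : ∀ k ≤ n + 1, Measurable (f k)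

theorem hasDerivAt_curveDeriv {n : ℕ} {f : ℕ → ℝ → ℝ} {k : ℕ} {x : ℝ}
    (h : HasDerivAt (f k) (f (k + 1) x) x) :
    HasDerivAt (curveDeriv n f k) (curveDeriv n f (k + 1) x) x := by
  rw [hasDerivAt_pi]
  intro i
  unfold curveDeriv
  by_cases hi : (i : ℕ) + 1 < n + 1
  · simp only [hi, if_true]
    by_cases hk : k ≤ (i : ℕ) + 1
    · simp only [hk, if_true]
      obtain ⟨m, hm⟩ := Nat.exists_eq_add_of_le hk
      rcases m with _ | m
      · have h1 : ¬ (k + 1 ≤ (i : ℕ) + 1) := by omega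
        have h2 : (i : ℕ) + 1 - k = 0 := by omega
        simp only [h1, if_false, h2]
        simpa using hasDerivAt_const x (1 : ℝ)
      · have h1 : k + 1 ≤ (i : ℕ) + 1 := by omega
        have h2 : (i : ℕ) + 1 - k = m + 1 := by omega
        have h3 : (i : ℕ) + 1 - (k + 1) = m := by omega
        simp only [h1, if_true, h2, h3]
        refine ((hasDerivAt_pow (m + 1) x).div_const _).congr_deriv ?_
        rw [Nat.factorial_succ]
        push_cast
        field_simp
    · have h1 : ¬ (k + 1 ≤ (i : ℕ) + 1) := by omega
      simp only [hk, h1, if_false]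
      exact hasDerivAt_const x 0
  · simp only [hi, if_false]
    exact h

/-- The polynomial coordinates have degree at most `n`. Hence the `n`-th derivative of the Jacobian
in its last variable reduces to a single minor. -/
theorem curveDeriv_top (n : ℕ) (f : ℕ → ℝ → ℝ) (x : ℝ) :
    curveDeriv n f (n + 1) x = Pi.single (Fin.last n) (f (n + 1) x) := by
  funext i
  unfold curveDeriv
  induction i using Fin.lastCases with
  | last => simp
  | cast i =>
    have h1 : ((i.castSucc : Fin (n + 1)) : ℕ) + 1 < n + 1 := by simp
    have h2 : ¬ (n + 1 ≤ ((i.castSucc : Fin (n + 1)) : ℕ) + 1) := by omega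
    rw [if_pos h1, if_neg h2, Pi.single_eq_of_ne (Fin.castSucc_lt_last i).ne]

theorem det_updateCol_last_single {n : ℕ} (A : Matrix (Fin (n + 1)) (Fin (n + 1)) ℝ) (c : ℝ) :
    (A.updateCol (Fin.last n) (Pi.single (Fin.last n) c)).det =
      c * (A.submatrix Fin.castSucc Fin.castSucc).det := by
  rw [Matrix.det_succ_column _ (Fin.last n), Fin.sum_univ_castSucc]
  have h1 : ∀ i : Fin n, (Pi.single (Fin.last n) c : Fin (n + 1) → ℝ) i.castSucc = 0 :=
    fun i => Pi.single_eq_of_ne (Fin.castSucc_lt_last i).ne _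
  simp only [Matrix.updateCol_self, h1, mul_zero, zero_mul, Finset.sum_const_zero, zero_add,
    Pi.single_eq_same]
  rw [← two_mul, pow_mul]
  simp only [even_two, Even.neg_pow, one_pow, one_mul]
  congr 2
  ext i j
  simp [Matrix.submatrix_apply]

theorem det_curveJacobian_minor (n : ℕ) (f : ℕ → ℝ → ℝ) (t : Fin (n + 1) → ℝ) :
    ((curveJacobian n f t).submatrix Fin.castSucc Fin.castSucc).det =
      (∏ i : Fin n, ((Nat.factorial (i : ℕ) : ℝ))⁻¹) *
        (Matrix.vandermonde fun i : Fin n => t i.castSucc).det := by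
  rw [← Matrix.det_transpose (Matrix.vandermonde _), ← Matrix.det_mul_column]
  congr 1
  ext i j
  simp [curveJacobian, curveDeriv, Matrix.vandermonde_apply, div_eq_inv_mul]

theorem det_vandermonde_pos {n : ℕ} {t : Fin n → ℝ} (ht : StrictMono t) :
    0 < (Matrix.vandermonde t).det := by
  rw [Matrix.det_vandermonde]
  exact Finset.prod_pos fun i _ => Finset.prod_pos fun j hj =>
    sub_pos.2 (ht (Finset.mem_Ioi.1 hj))

theorem hasDerivAt_det_updateCol {n : ℕ} (A : Matrix (Fin (n + 1)) (Fin (n + 1)) ℝ)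
    {g : ℝ → Fin (n + 1) → ℝ} {g' : Fin (n + 1) → ℝ} {x : ℝ} (h : HasDerivAt g g' x)
    (j : Fin (n + 1)) :
    HasDerivAt (fun y => (A.updateCol j (g y)).det) (A.updateCol j g').det x := by
  have h1 := ((LinearMap.toContinuousLinearMap (Matrix.cramer A)).hasFDerivAt).comp_hasDerivAt x h
  have h2 := (hasDerivAt_pi.1 h1) j
  exact h2

/-- A lower bound for the Jacobian determinant, in terms of a lower bound `m` for `f (n + 1)` to the
right of `p`. -/
theorem det_curveJacobian_lower_bound (n : ℕ) : ∃ c : ℝ, 0 < c ∧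
    ∀ (f : ℕ → ℝ → ℝ) (I : Set ℝ), IsDerivChain n f I →
    ∀ (t : Fin (n + 1) → ℝ), StrictMono t → (∀ i, t i ∈ I) →
    ∀ p m : ℝ, p < t (Fin.last n) → 0 ≤ m → (∀ x ∈ I, p ≤ x → m ≤ f (n + 1) x) →
      c * m * (Matrix.vandermonde fun i : Fin n => t i.castSucc).det *
        ∏ i : Fin n, (t (Fin.last n) - max (t i.castSucc) p) ≤ (curveJacobian n f t).det := by
  obtain ⟨c, hc, H⟩ := interp_error_lower_bound n
  have hfac : 0 < ∏ i : Fin n, ((Nat.factorial (i : ℕ) : ℝ))⁻¹ :=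
    Finset.prod_pos fun i _ => by positivity
  refine ⟨c * ∏ i : Fin n, ((Nat.factorial (i : ℕ) : ℝ))⁻¹, by positivity,
    fun f I hf t ht htI p m hp hm hmp => ?_⟩
  set T := t (Fin.last n) with hT
  set A := curveJacobian n f t with hA
  have hV : 0 < (Matrix.vandermonde fun i : Fin n => t i.castSucc).det :=
    det_vandermonde_pos fun i j hij => ht (Fin.castSucc_lt_castSucc_iff.2 hij)
  obtain ⟨α, hα, hαI⟩ : ∃ α < t 0, Set.Ioc α (t 0) ⊆ I :=
    (mem_nhdsLE_iff_exists_Ioc_subset' (sub_one_lt (t 0))).1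
      (mem_nhdsWithin_of_mem_nhds (hf.isOpen.mem_nhds (htI 0)))
  have hsub : Set.Ioc α T ⊆ I := by
    intro x hx
    rcases le_total x (t 0) with h | h
    · exact hαI ⟨hx.1, h⟩
    · exact hf.ordConnected.out (htI 0) (htI (Fin.last n)) ⟨h, hx.2⟩
  have hKn : ∀ x, (A.updateCol (Fin.last n) (curveDeriv n f (n + 1) x)).det =
      f (n + 1) x * ((∏ i : Fin n, ((Nat.factorial (i : ℕ) : ℝ))⁻¹) *
        (Matrix.vandermonde fun i : Fin n => t i.castSucc).det) := fun x => by
    rw [curveDeriv_top, det_updateCol_last_single, det_curveJacobian_minor]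
  -- The interpolated function is the determinant with `γ'(x)` as last column. It vanishes at the
  -- earlier entries, where two columns coincide, and its `n`-th derivative is `f (n + 1) x` times a
  -- scaled Vandermonde determinant.
  have h1 := H (fun k x => (A.updateCol (Fin.last n) (curveDeriv n f (k + 1) x)).det) α T p
    (m * ((∏ i : Fin n, ((Nat.factorial (i : ℕ) : ℝ))⁻¹) *
      (Matrix.vandermonde fun i : Fin n => t i.castSucc).det)) (fun i => t i.castSucc)
    (by positivity) hp (hα.trans_le (ht.monotone (Fin.zero_le _)))
    (fun i => hα.trans_le (ht.monotone (Fin.zero_le _)))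
    (fun i j hij => ht (Fin.castSucc_lt_castSucc_iff.2 hij)) (fun i => ht (Fin.castSucc_lt_last i))
    (fun k hk x hx => hasDerivAt_det_updateCol A
      (hasDerivAt_curveDeriv (hf.hasDerivAt (k + 1) (by omega) x (hsub hx))) _)
    (fun x hx => by
      rw [hKn]
      exact mul_nonneg (hf.pos x (hsub hx)).le (by positivity))
    (fun x hx hpx => by
      rw [hKn]
      exact mul_le_mul_of_nonneg_right (hmp x (hsub hx) hpx) (by positivity))
    (fun i => by
      refine Matrix.det_zero_of_column_eq (Fin.castSucc_lt_last i).ne fun k => ?_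
      rw [Matrix.updateCol_self, Matrix.updateCol_ne (Fin.castSucc_lt_last i).ne]
      rfl)
  have h2 : A.updateCol (Fin.last n) (curveDeriv n f (0 + 1) T) = A := by
    ext i j
    by_cases hj : j = Fin.last n
    · subst hj
      rw [Matrix.updateCol_self]
      rfl
    · rw [Matrix.updateCol_ne hj]
  simp only [h2] at h1
  refine le_trans (le_of_eq ?_) h1
  ring

theorem det_curveJacobian_pos {n : ℕ} {f : ℕ → ℝ → ℝ} {I : Set ℝ} (hf : IsDerivChain n f I)
    {t : Fin (n + 1) → ℝ} (ht : StrictMono t) (htI : ∀ i, t i ∈ I) :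
    0 < (curveJacobian n f t).det := by
  obtain ⟨c, hc, H⟩ := det_curveJacobian_lower_bound n
  rcases n with _ | n
  · have : (curveJacobian 0 f t).det = f 1 (t 0) := by
      simp [curveJacobian, curveDeriv]
    rw [this]
    exact hf.pos _ (htI 0)
  -- With at least two entries, the first one lies strictly below the last and serves as threshold.
  · have h := H f I hf t ht htI (t 0) (f (n + 2) (t 0)) (ht (Fin.last_pos))
      (hf.pos _ (htI 0)).le
      (fun x hx h0 => hf.strictMonoOn.monotoneOn (htI 0) hx h0)
    refine lt_of_lt_of_le ?_ h
    have h1 := hf.pos _ (htI 0)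
    have h2 := det_vandermonde_pos (t := fun i : Fin (n + 1) => t i.castSucc)
      fun i j hij => ht (Fin.castSucc_lt_castSucc_iff.2 hij)
    have h3 : 0 < ∏ i : Fin (n + 1), (t (Fin.last (n + 1)) - max (t i.castSucc) (t 0)) :=
      Finset.prod_pos fun i _ => sub_pos.2 (max_lt (ht (Fin.castSucc_lt_last i)) (ht Fin.last_pos))
    positivity

/-- Sorting multiplies both determinants by the same sign, so their product does not change. -/
theorem det_curveJacobian_mul_vandermonde_pos {n : ℕ} {f : ℕ → ℝ → ℝ} {I : Set ℝ}
    (hf : IsDerivChain n f I) {t : Fin (n + 1) → ℝ} (ht : Function.Injective t)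
    (htI : ∀ i, t i ∈ I) :
    0 < (curveJacobian n f t).det * (Matrix.vandermonde t).det := by
  set σ := Tuple.sort t with hσ
  have hmono : StrictMono (t ∘ σ) :=
    (Tuple.monotone_sort t).strictMono_of_injective (ht.comp σ.injective)
  have h1 := det_curveJacobian_pos hf hmono fun i => htI _
  have h2 := det_vandermonde_pos hmono
  have h3 : curveJacobian n f (t ∘ σ) = (curveJacobian n f t).submatrix id σ := rfl
  have h4 : Matrix.vandermonde (t ∘ σ) = (Matrix.vandermonde t).submatrix σ id := rfl
  rw [h3, Matrix.det_permute'] at h1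
  rw [h4, Matrix.det_permute] at h2
  have h5 := mul_pos h1 h2
  rcases Int.units_eq_one_or (Equiv.Perm.sign σ) with h | h <;> simpa [h] using h5

/-! ### Injectivity of the sum map on increasing tuples -/

/-- Newton's identities express each elementary symmetric function through power sums and lower
ones. -/
theorem aeval_esymm_eq_of_sum_pow_eq {m K : ℕ} {t s : Fin m → ℝ}
    (h : ∀ k, 1 ≤ k → k ≤ K → ∑ i, t i ^ k = ∑ i, s i ^ k) :
    ∀ k ≤ K, MvPolynomial.aeval t (MvPolynomial.esymm (Fin m) ℝ k) =
      MvPolynomial.aeval s (MvPolynomial.esymm (Fin m) ℝ k) := by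
  intro k
  induction k using Nat.strong_induction_on with
  | _ k ih =>
    intro hk
    rcases Nat.eq_zero_or_pos k with rfl | hpos
    · simp
    have hk0 : (k : ℝ) ≠ 0 := by exact_mod_cast hpos.ne'
    have h1 := congrArg (MvPolynomial.aeval t) (MvPolynomial.mul_esymm_eq_sum (Fin m) ℝ k)
    have h2 := congrArg (MvPolynomial.aeval s) (MvPolynomial.mul_esymm_eq_sum (Fin m) ℝ k)
    simp only [map_mul, map_natCast, map_pow, map_neg, map_one, map_sum] at h1 h2
    refine mul_left_cancel₀ hk0 ?_
    rw [h1, h2]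
    congr 1
    refine Finset.sum_congr rfl fun a ha => ?_
    rw [Finset.mem_filter, Finset.HasAntidiagonal.mem_antidiagonal] at ha
    rw [ih a.1 ha.2 (by omega)]
    congr 1
    simp only [MvPolynomial.psum, map_sum, map_pow, MvPolynomial.aeval_X]
    exact h a.2 (by omega) (by omega)

theorem natDegree_prod_X_sub_C {n : ℕ} (v : Fin n → ℝ) :
    (∏ i, (Polynomial.X - Polynomial.C (v i))).natDegree = n := by
  rw [Polynomial.natDegree_prod_of_monic _ _ fun i _ => Polynomial.monic_X_sub_C (v i)]
  simp

theorem mem_range_iff_eval_prod_X_sub_C_eq_zero {n : ℕ} (v : Fin n → ℝ) (x : ℝ) :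
    x ∈ Set.range v ↔ (∏ i, (Polynomial.X - Polynomial.C (v i))).eval x = 0 := by
  simp only [Set.mem_range, Polynomial.eval_prod, Finset.prod_eq_zero_iff, Finset.mem_univ,
    true_and, Polynomial.eval_sub, Polynomial.eval_X, Polynomial.eval_C, sub_eq_zero]
  exact exists_congr fun i => eq_comm

/-- The given power sums determine every coefficient except the constant one, which differentiation
removes. -/
theorem derivative_prod_X_sub_C_eq {n : ℕ} {t s : Fin (n + 1) → ℝ}
    (h : ∀ k, 1 ≤ k → k ≤ n → ∑ i, t i ^ k = ∑ i, s i ^ k) :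
    (∏ i, (Polynomial.X - Polynomial.C (t i))).derivative =
      (∏ i, (Polynomial.X - Polynomial.C (s i))).derivative := by
  have key : ∀ (v : Fin (n + 1) → ℝ) (k : ℕ), k ≤ n + 1 →
      (∏ i, (Polynomial.X - Polynomial.C (v i))).coeff k = (-1) ^ (n + 1 - k) *
        MvPolynomial.aeval v (MvPolynomial.esymm (Fin (n + 1)) ℝ (n + 1 - k)) := by
    intro v k hk
    have h1 := Multiset.prod_X_sub_C_coeff (Finset.univ.val.map v) (k := k) (by simpa using hk)
    rw [MvPolynomial.aeval_esymm_eq_multiset_esymm]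
    rw [Multiset.map_map, Multiset.card_map, Finset.card_val, Finset.card_univ, Fintype.card_fin]
      at h1
    exact h1
  ext k
  rw [Polynomial.coeff_derivative, Polynomial.coeff_derivative]
  congr 1
  rcases le_or_gt (k + 1) (n + 1) with hk | hk
  · rw [key _ _ hk, key _ _ hk, aeval_esymm_eq_of_sum_pow_eq h _ (by omega)]
  · rw [Polynomial.coeff_eq_zero_of_natDegree_lt, Polynomial.coeff_eq_zero_of_natDegree_lt]
    all_goals rwa [natDegree_prod_X_sub_C]

/-- Rolle gives `n` zeros of the derivative; degree and leading coefficient then force the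
factorisation. -/
theorem exists_interlacing_roots_derivative {n : ℕ} {t : Fin (n + 1) → ℝ} (ht : StrictMono t) :
    ∃ g : Fin n → ℝ, StrictMono g ∧ (∀ i, t i.castSucc < g i ∧ g i < t i.succ) ∧
      (∏ i, (Polynomial.X - Polynomial.C (t i))).derivative =
        Polynomial.C ((n : ℝ) + 1) * ∏ i, (Polynomial.X - Polynomial.C (g i)) := by
  set P : Polynomial ℝ := ∏ i, (Polynomial.X - Polynomial.C (t i)) with hP
  have hroot : ∀ i, P.eval (t i) = 0 := fun i => by
    rw [hP, Polynomial.eval_prod]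
    exact Finset.prod_eq_zero (Finset.mem_univ i) (by simp)
  have hex : ∀ i : Fin n, ∃ g ∈ Set.Ioo (t i.castSucc) (t i.succ), P.derivative.eval g = 0 :=
    fun i => exists_hasDerivAt_eq_zero (ht Fin.castSucc_lt_succ) P.continuous.continuousOn
      (by rw [hroot, hroot]) fun x _ => P.hasDerivAt x
  choose g hg hg0 using hex
  have hmono : StrictMono g := fun i j hij =>
    (hg i).2.trans ((ht.monotone (Fin.succ_le_castSucc_iff.2 hij)).trans_lt (hg j).1)
  refine ⟨g, hmono, hg, ?_⟩
  have hmonic : P.Monic := Polynomial.monic_prod_of_monic _ _ fun i _ => Polynomial.monic_X_sub_C _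
  have hdeg : P.natDegree = n + 1 := natDegree_prod_X_sub_C t
  set R : Polynomial ℝ := ∏ i, (Polynomial.X - Polynomial.C (g i)) with hR
  have hmonicR : R.Monic := Polynomial.monic_prod_of_monic _ _ fun i _ => Polynomial.monic_X_sub_C _
  have hdegR : R.natDegree = n := natDegree_prod_X_sub_C g
  have hn : ((n : ℝ) + 1) ≠ 0 := by positivity
  refine Polynomial.eq_of_degree_sub_lt_of_eval_index_eq (s := Finset.univ) (v := g)
    (fun i _ j _ hij => hmono.injective hij) ?_ fun i _ => ?_
  · rw [Finset.card_univ, Fintype.card_fin, Polynomial.degree_lt_iff_coeff_zero]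
    intro k hk
    rw [Polynomial.coeff_sub, Polynomial.coeff_derivative, Polynomial.coeff_C_mul]
    rcases hk.eq_or_lt with rfl | hk
    · have h1 : P.coeff (n + 1) = 1 := by rw [← hdeg]; exact hmonic
      have h2 : R.coeff n = 1 := by nth_rewrite 1 [← hdegR]; exact hmonicR
      rw [h1, h2]
      ring
    · rw [Polynomial.coeff_eq_zero_of_natDegree_lt (p := P) (by omega),
        Polynomial.coeff_eq_zero_of_natDegree_lt (p := R) (by omega)]
      ring
  · rw [hg0, Polynomial.eval_mul, hR, Polynomial.eval_prod,
      Finset.prod_eq_zero (Finset.mem_univ i) (by simp), mul_zero]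

theorem exists_between_ratio_slope {F F' G G' : ℝ → ℝ} {x y : ℝ} (hxy : x ≠ y)
    (hF : ∀ z ∈ Set.uIcc x y, HasDerivAt F (F' z) z)
    (hG : ∀ z ∈ Set.uIcc x y, HasDerivAt G (G' z) z) :
    ∃ z ∈ Set.Ioo (min x y) (max x y), (G y - G x) * F' z = (F y - F x) * G' z := by
  obtain ⟨z, hz, h⟩ := exists_ratio_hasDerivAt_eq_ratio_slope F F' (min_lt_max.2 hxy)
    (fun z hz => (hF z hz).continuousAt.continuousWithinAt)
    (fun z hz => hF z (Set.Ioo_subset_Icc_self hz)) G G'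
    (fun z hz => (hG z hz).continuousAt.continuousWithinAt)
    (fun z hz => hG z (Set.Ioo_subset_Icc_self hz))
  refine ⟨z, hz, ?_⟩
  rcases le_total x y with h' | h'
  · simpa [h'] using h
  · simp only [max_eq_left h', min_eq_right h'] at h
    linarith

/-- A strictly increasing tuple `t` is determined by `∑ j, γ (t j)`. -/
theorem injOn_sum_curve {n : ℕ} {f : ℕ → ℝ → ℝ} {I : Set ℝ} (hf : IsDerivChain n f I) :
    Set.InjOn (fun t : Fin (n + 1) → ℝ => ∑ j, curveDeriv n f 0 (t j))
      {t | StrictMono t ∧ ∀ i, t i ∈ I} := by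
  rintro t ⟨ht, htI⟩ s ⟨hs, hsI⟩ hts
  simp only at hts
  have hpow : ∀ k, 1 ≤ k → k ≤ n → ∑ i, t i ^ k = ∑ i, s i ^ k := by
    intro k h1 hk
    have h2 := congrFun hts ⟨k - 1, by omega⟩
    have h4 : k - 1 + 1 = k := by omega
    have h5 : k < n + 1 := by omega
    simp only [Finset.sum_apply, curveDeriv, if_true, zero_le, Nat.sub_zero, h4, h5] at h2
    rw [← Finset.sum_div, ← Finset.sum_div] at h2
    exact (div_left_inj' (by positivity)).1 h2
  have hder := derivative_prod_X_sub_C_eq hpow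
  obtain ⟨g, hg, hgt, hPg⟩ := exists_interlacing_roots_derivative ht
  obtain ⟨g', hg', hgs, hQg⟩ := exists_interlacing_roots_derivative hs
  set P : Polynomial ℝ := ∏ i, (Polynomial.X - Polynomial.C (t i)) with hP
  set Q : Polynomial ℝ := ∏ i, (Polynomial.X - Polynomial.C (s i)) with hQ
  have hn : ((n : ℝ) + 1) ≠ 0 := by positivity
  have hgg : g = g' := by
    have h1 : ∏ i, (Polynomial.X - Polynomial.C (g i)) =
        ∏ i, (Polynomial.X - Polynomial.C (g' i)) :=
      mul_left_cancel₀ (Polynomial.C_ne_zero.2 hn) (hPg.symm.trans (hder.trans hQg))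
    refine (StrictMono.range_inj hg hg').1 (Set.ext fun x => ?_)
    rw [mem_range_iff_eval_prod_X_sub_C_eq_zero, mem_range_iff_eval_prod_X_sub_C_eq_zero, h1]
  subst hgg
  obtain ⟨c, hc⟩ : ∃ c, ∀ x, P.eval x = Q.eval x + c := by
    have h1 : (P - Q).derivative = 0 := by rw [Polynomial.derivative_sub, hder, sub_self]
    have h2 := Polynomial.eq_C_of_natDegree_eq_zero
      (Polynomial.derivative_eq_zero.1 h1)
    refine ⟨(P - Q).coeff 0, fun x => ?_⟩
    have h3 := congrArg (Polynomial.eval x) h2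
    rw [Polynomial.eval_sub, Polynomial.eval_C] at h3
    linarith
  have hPt : ∀ i, P.eval (t i) = 0 := fun i => by
    rw [hP, Polynomial.eval_prod]
    exact Finset.prod_eq_zero (Finset.mem_univ i) (by simp)
  have hQs : ∀ i, Q.eval (s i) = 0 := fun i => by
    rw [hQ, Polynomial.eval_prod]
    exact Finset.prod_eq_zero (Finset.mem_univ i) (by simp)
  by_cases hc0 : c = 0
  · refine (StrictMono.range_inj ht hs).1 (Set.ext fun x => ?_)
    rw [mem_range_iff_eval_prod_X_sub_C_eq_zero, mem_range_iff_eval_prod_X_sub_C_eq_zero,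
      ← hP, ← hQ, hc x, hc0, add_zero]
  exfalso
  set A := curveJacobian n f (Fin.cons 0 g) with hA
  set H : ℝ → ℝ := fun x => (A.updateCol 0 (curveDeriv n f 0 x)).det with hH
  have hHd : ∀ x ∈ I, HasDerivAt H (curveJacobian n f (Fin.cons x g)).det x := by
    intro x hx
    have h1 := hasDerivAt_det_updateCol A (hasDerivAt_curveDeriv (hf.hasDerivAt 0 (by omega) x hx)) 0
    convert h1 using 2
    ext i j
    induction j using Fin.cases with
    | zero => simp [curveJacobian]
    | succ j => simp [curveJacobian, hA]
  have hsum : ∑ i, (H (s i) - H (t i)) = 0 := by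
    have h1 : ∀ v : Fin (n + 1) → ℝ,
        ∑ i, H (v i) = (Matrix.cramer A (∑ i, curveDeriv n f 0 (v i))) 0 := by
      intro v
      rw [map_sum, Finset.sum_apply]
      rfl
    rw [Finset.sum_sub_distrib, h1, h1, hts, sub_self]
  have hgI : ∀ i, g i ∈ I := fun i =>
    hf.ordConnected.out (htI _) (htI _) ⟨(hgt i).1.le, (hgt i).2.le⟩
  -- No common critical point separates `t i` from `s i`, and `P (s i) - P (t i) = c`. Cauchy's mean
  -- value theorem then gives all the increments of `H` the same strict sign, although they sum to
  -- zero.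
  have hpos : ∀ i, 0 < (-1) ^ n * c * (H (s i) - H (t i)) := by
    intro i
    have hne : t i ≠ s i := by
      intro h
      have h1 := hc (t i)
      rw [hPt, h, hQs, zero_add] at h1
      exact hc0 h1.symm
    have hsub : Set.uIcc (t i) (s i) ⊆ I := hf.ordConnected.uIcc_subset (htI i) (hsI i)
    obtain ⟨z, hz, hzeq⟩ := exists_between_ratio_slope (F := fun x => P.eval x)
      (F' := fun x => P.derivative.eval x) (G := H) hne (fun x _ => P.hasDerivAt x)
      fun x hx => hHd x (hsub hx)
    have hzI : z ∈ I := hsub (Set.Ioo_subset_Icc_self hz)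
    have hzg : ∀ k, z ≠ g k := by
      rintro k rfl
      rcases le_or_gt k.succ i with hk | hk
      · have h1 := (hgt k).2.trans_le (ht.monotone hk)
        have h2 := (hgs k).2.trans_le (hs.monotone hk)
        exact absurd hz.1 (not_lt.2 (le_min h1.le h2.le))
      · have hk' : i ≤ k.castSucc := Fin.le_castSucc_iff.2 hk
        have h1 := (ht.monotone hk').trans_lt (hgt k).1
        have h2 := (hs.monotone hk').trans_lt (hgs k).1
        exact absurd hz.2 (not_lt.2 (max_le h1.le h2.le))
    have hinj : Function.Injective (Fin.cons z g : Fin (n + 1) → ℝ) := by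
      rw [Fin.cons_injective_iff]
      exact ⟨fun ⟨k, hk⟩ => hzg k hk.symm, hg.injective⟩
    have hJ := det_curveJacobian_mul_vandermonde_pos hf hinj (by
      intro k
      induction k using Fin.cases with
      | zero => simpa using hzI
      | succ k => simpa using hgI k)
    have hV : (Matrix.vandermonde (Fin.cons z g : Fin (n + 1) → ℝ)).det =
        (-1) ^ n * (∏ k, (z - g k)) * (Matrix.vandermonde g).det := by
      rw [Matrix.det_vandermonde, Matrix.det_vandermonde, Fin.prod_univ_succ]
      simp only [Fin.prod_Ioi_zero, Fin.prod_Ioi_succ, Fin.cons_succ, Fin.cons_zero]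
      congr 1
      have h1 : ∏ k, (g k - z) = ∏ k, (-1 * (z - g k)) :=
        Finset.prod_congr rfl fun k _ => by ring
      rw [h1, Finset.prod_mul_distrib]
      simp
    have hP' : P.derivative.eval z = (n + 1) * ∏ k, (z - g k) := by
      rw [hPg]
      simp [Polynomial.eval_prod]
    have hVg := det_vandermonde_pos hg
    rw [hV] at hJ
    set D := (curveJacobian n f (Fin.cons z g)).det
    set W := ∏ k, (z - g k)
    have hJ2 : 0 < (-1) ^ n * (D * W) := by
      refine pos_of_mul_pos_left (b := (Matrix.vandermonde g).det) ?_ hVg.le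
      linarith
    have hW : W ≠ 0 := by
      rintro h
      rw [h] at hJ2
      simp at hJ2
    simp only [hP'] at hzeq
    rw [hPt, hc (s i), hQs, zero_add, sub_zero] at hzeq
    have h6 : 0 < ((n : ℝ) + 1) * W ^ 2 := by positivity
    have h7 : 0 < c ^ 2 := by positivity
    have h8 : ((-1) ^ n * c * (H (s i) - H (t i))) * (((n : ℝ) + 1) * W ^ 2) =
        c ^ 2 * ((-1) ^ n * (D * W)) := by
      linear_combination (-1) ^ n * c * W * hzeq
    exact pos_of_mul_pos_left (h8 ▸ mul_pos h7 hJ2) h6.le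
  have h1 : 0 < ∑ i, (-1) ^ n * c * (H (s i) - H (t i)) :=
    Finset.sum_pos (fun i _ => hpos i) Finset.univ_nonempty
  rw [← Finset.mul_sum, hsum, mul_zero] at h1
  exact lt_irrefl _ h1

/-! ### Change of variables and measurability -/

theorem hasFDerivAt_sum_curve {n : ℕ} {f : ℕ → ℝ → ℝ} {I : Set ℝ} (hf : IsDerivChain n f I)
    {t : Fin (n + 1) → ℝ} (htI : ∀ i, t i ∈ I) :
    HasFDerivAt (fun t : Fin (n + 1) → ℝ => ∑ j, curveDeriv n f 0 (t j))
      (LinearMap.toContinuousLinearMap (Matrix.toLin' (curveJacobian n f t))) t := by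
  have h1 : HasFDerivAt (fun t : Fin (n + 1) → ℝ => ∑ j, curveDeriv n f 0 (t j))
      (∑ j, (ContinuousLinearMap.toSpanSingleton ℝ (curveDeriv n f 1 (t j))).comp
        (ContinuousLinearMap.proj (R := ℝ) (φ := fun _ : Fin (n + 1) => ℝ) j)) t := by
    refine HasFDerivAt.fun_sum fun j _ => ?_
    exact (hasDerivAt_curveDeriv (hf.hasDerivAt 0 (by omega) (t j) (htI j))).hasFDerivAt.comp
      (f := fun t : Fin (n + 1) → ℝ => t j) t
      (hasFDerivAt_apply j t)
  refine h1.congr_fderiv ?_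
  ext v i
  simp [Matrix.toLin'_apply, Matrix.mulVec, dotProduct, curveJacobian, mul_comm]

theorem measurableSet_strictMono (n : ℕ) {I : Set ℝ} (hI : MeasurableSet I) :
    MeasurableSet {t : Fin n → ℝ | StrictMono t ∧ ∀ i, t i ∈ I} := by
  have h1 : {t : Fin n → ℝ | StrictMono t ∧ ∀ i, t i ∈ I} =
      (⋂ i, ⋂ j, {t : Fin n → ℝ | i < j → t i < t j}) ∩ ⋂ i, {t | t i ∈ I} := by
    ext t
    simp [StrictMono]
  rw [h1]
  refine MeasurableSet.inter (MeasurableSet.iInter fun i => MeasurableSet.iInter fun j => ?_)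
    (MeasurableSet.iInter fun i => measurable_pi_apply i hI)
  by_cases hij : i < j
  · simpa [hij] using measurableSet_lt (measurable_pi_apply i) (measurable_pi_apply j)
  · simp [hij]

/-- The change of variables `x = ∑ j, γ (t j)`. -/
theorem lintegral_det_curveJacobian_le {n : ℕ} {f : ℕ → ℝ → ℝ} {I : Set ℝ}
    (hf : IsDerivChain n f I) {F : Set (Fin (n + 1) → ℝ)} (hF : MeasurableSet F) :
    ∫⁻ t in {t : Fin (n + 1) → ℝ | StrictMono t ∧ ∀ i, t i ∈ I},
      ENNReal.ofReal (curveJacobian n f t).det *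
        F.indicator (fun _ => (1 : ℝ≥0∞)) (∑ j, curveDeriv n f 0 (t j)) ≤ volume F := by
  have hS := measurableSet_strictMono (n + 1) hf.isOpen.measurableSet
  have h1 := lintegral_image_eq_lintegral_abs_det_fderiv_mul volume hS
    (fun t ht => (hasFDerivAt_sum_curve hf ht.2).hasFDerivWithinAt) (injOn_sum_curve hf)
    (F.indicator fun _ => (1 : ℝ≥0∞))
  calc _ = ∫⁻ t in {t : Fin (n + 1) → ℝ | StrictMono t ∧ ∀ i, t i ∈ I},
      ENNReal.ofReal |(LinearMap.toContinuousLinearMap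
        (Matrix.toLin' (curveJacobian n f t))).det| *
        F.indicator (fun _ => (1 : ℝ≥0∞)) (∑ j, curveDeriv n f 0 (t j)) := by
        refine setLIntegral_congr_fun hS fun t ht => ?_
        have h2 : (LinearMap.toContinuousLinearMap (Matrix.toLin' (curveJacobian n f t))).det =
            (curveJacobian n f t).det := by
          rw [ContinuousLinearMap.det, LinearMap.coe_toContinuousLinearMap, LinearMap.det_toLin']
        simp only [h2, abs_of_pos (det_curveJacobian_pos hf ht.1 ht.2)]
    _ ≤ ∫⁻ x, F.indicator (fun _ => (1 : ℝ≥0∞)) x := by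
        rw [← h1]
        exact setLIntegral_le_lintegral _ _
    _ = volume F := by
        rw [lintegral_indicator hF, setLIntegral_const, one_mul]

theorem measurable_curveDeriv {n : ℕ} {f : ℕ → ℝ → ℝ} {k : ℕ} (hf : Measurable (f k)) :
    Measurable (curveDeriv n f k) := by
  rw [measurable_pi_iff]
  intro i
  unfold curveDeriv
  split_ifs
  · fun_prop
  · fun_prop
  · exact hf

theorem measurable_det_curveJacobian {n : ℕ} {f : ℕ → ℝ → ℝ} (hf : Measurable (f 1)) :
    Measurable fun t : Fin (n + 1) → ℝ => (curveJacobian n f t).det := by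
  have h : ∀ i j, Measurable fun t : Fin (n + 1) → ℝ => curveJacobian n f t i j := fun i j =>
    (measurable_pi_iff.1 (measurable_curveDeriv hf) i).comp (measurable_pi_apply j)
  simp only [Matrix.det_apply]
  refine Finset.measurable_fun_sum _ fun σ _ => ?_
  refine Measurable.const_smul ?_ _
  exact Finset.measurable_fun_prod _ fun i _ => h _ _

/-! ### Linear inequalities between logarithms of gaps and levels -/

theorem sum_range_sum_range_succ (u : ℕ → ℝ) (n : ℕ) :
    ∑ j ∈ Finset.range n, ∑ i ∈ Finset.range j, u (i + 1) =
      n * ∑ i ∈ Finset.range n, u (i + 1) - ∑ i ∈ Finset.range n, ((i : ℝ) + 1) * u (i + 1) := by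
  induction n with
  | zero => simp
  | succ n ih =>
    rw [Finset.sum_range_succ, ih, Finset.sum_range_succ, Finset.sum_range_succ]
    push_cast
    ring

theorem sum_range_mul_eq (u : ℕ → ℝ) (n : ℕ) :
    ∑ j ∈ Finset.range n, (j : ℝ) * u j =
      ∑ i ∈ Finset.range n, ((i : ℝ) + 1) * u (i + 1) - n * u n := by
  induction n with
  | zero => simp
  | succ n ih =>
    rw [Finset.sum_range_succ, ih, Finset.sum_range_succ]
    push_cast
    ring

theorem sum_range_add_one (n : ℕ) : ∑ i ∈ Finset.range n, ((i : ℝ) + 1) = n * (n + 1) / 2 := by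
  induction n with
  | zero => simp
  | succ n ih =>
    rw [Finset.sum_range_succ, ih]
    push_cast
    ring

/-- Averaging the lower bounds for the logarithm of the Jacobian over the `n + 1` choices of the
threshold, with weight `θ` for each positive index and the remaining weight for the index `0`. -/
theorem averaged_log_bound {n : ℕ} {θ R : ℝ} (hθ0 : 0 ≤ θ) (hθ : n * θ ≤ 1) {u κ : ℕ → ℝ}
    (hκ0 : κ 0 = 0)
    (h : ∀ j ≤ n, κ j + (∑ l ∈ Finset.range n, ∑ i ∈ Finset.range l,
        ((1 + θ) / 2 * u (i + 1) + (1 - θ) / 2 * u l)) +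
      ∑ i ∈ Finset.range n, (if j ≤ i + 1 then max (u (i + 1)) (u n) else u n) ≤ R) :
    θ * ∑ i ∈ Finset.range n, κ (i + 1) + ((n : ℝ) + 1) / 2 * ∑ i ∈ Finset.range n, u (i + 1) +
      (1 - n * θ) / 2 * ∑ i ∈ Finset.range n, |u (i + 1) - u n| ≤ R := by
  set A := ∑ l ∈ Finset.range n, ∑ i ∈ Finset.range l,
    ((1 + θ) / 2 * u (i + 1) + (1 - θ) / 2 * u l) with hA
  set S1 := ∑ i ∈ Finset.range n, u (i + 1) with hS1
  set S2 := ∑ i ∈ Finset.range n, ((i : ℝ) + 1) * u (i + 1) with hS2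
  -- The weights `(1 ± θ)/2` are tuned so that the terms in `S2` and `u n` cancel against those
  -- coming from the maxima, leaving the coefficient `(n + 1)/2` on every `u (i + 1)`.
  have hA' : A = (1 + θ) / 2 * (n * S1 - S2) + (1 - θ) / 2 * (S2 - n * u n) := by
    rw [← sum_range_sum_range_succ, ← sum_range_mul_eq, hA, Finset.mul_sum, Finset.mul_sum,
      ← Finset.sum_add_distrib]
    refine Finset.sum_congr rfl fun l _ => ?_
    rw [Finset.sum_add_distrib, ← Finset.mul_sum, Finset.sum_const, Finset.card_range]
    simp only [nsmul_eq_mul]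
    ring
  set y : ℕ → ℝ := fun i => max (u (i + 1)) (u n) - u n with hy
  have hB : ∀ j, ∑ i ∈ Finset.range n, (if j ≤ i + 1 then max (u (i + 1)) (u n) else u n) =
      n * u n + ∑ i ∈ Finset.range n, (if j ≤ i + 1 then y i else 0) := by
    intro j
    rw [← nsmul_eq_mul, ← Finset.card_range n, ← Finset.sum_const, Finset.card_range,
      ← Finset.sum_add_distrib]
    refine Finset.sum_congr rfl fun i _ => ?_
    split_ifs <;> simp [hy]
  have h0 := h 0 (Nat.zero_le _)
  rw [hB, hκ0] at h0
  simp only [Nat.zero_le, if_true] at h0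
  have h1 : ∑ j ∈ Finset.range n, (κ (j + 1) + A + (n * u n +
      ∑ i ∈ Finset.range n, (if j + 1 ≤ i + 1 then y i else 0))) ≤ ∑ _j ∈ Finset.range n, R := by
    refine Finset.sum_le_sum fun j hj => ?_
    rw [← hB]
    exact h (j + 1) (Finset.mem_range.1 hj)
  have h2 : ∑ j ∈ Finset.range n, ∑ i ∈ Finset.range n, (if j + 1 ≤ i + 1 then y i else 0) =
      ∑ i ∈ Finset.range n, ((i : ℝ) + 1) * y i := by
    rw [Finset.sum_comm]
    refine Finset.sum_congr rfl fun i hi => ?_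
    rw [← Finset.sum_filter]
    have : (Finset.range n).filter (fun j => j + 1 ≤ i + 1) = Finset.range (i + 1) := by
      ext j
      simp only [Finset.mem_filter, Finset.mem_range] at hi ⊢
      omega
    rw [this, Finset.sum_const, Finset.card_range]
    simp
  simp only [Finset.sum_add_distrib, Finset.sum_const, Finset.card_range, nsmul_eq_mul, h2] at h1
  have h3 : ∑ i ∈ Finset.range n, ((1 / 2 - θ * n / 2 + θ * ((i : ℝ) + 1)) * (u (i + 1) - u n) +
      (1 - n * θ) / 2 * |u (i + 1) - u n|) ≤
      ∑ i ∈ Finset.range n, ((1 - n * θ) * y i + θ * (((i : ℝ) + 1) * y i)) := by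
    refine Finset.sum_le_sum fun i _ => ?_
    rcases le_total (u n) (u (i + 1)) with h' | h'
    · rw [hy]
      simp only [max_eq_left h']
      rw [abs_of_nonneg (sub_nonneg.2 h')]
      exact le_of_eq (by ring)
    · rw [hy]
      simp only [max_eq_right h']
      rw [abs_of_nonpos (sub_nonpos.2 h')]
      have : 0 ≤ θ * ((i : ℝ) + 1) * (u n - u (i + 1)) :=
        mul_nonneg (by positivity) (sub_nonneg.2 h')
      nlinarith
  have h4 : ∑ i ∈ Finset.range n, (1 / 2 - θ * n / 2 + θ * ((i : ℝ) + 1)) * (u (i + 1) - u n) =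
      (1 / 2 - θ * n / 2) * S1 + θ * S2 - (1 / 2 - θ * n / 2) * n * u n -
        θ * (n * (n + 1) / 2) * u n := by
    rw [← sum_range_add_one, hS1, hS2, Finset.mul_sum, Finset.mul_sum, Finset.mul_sum,
      Finset.sum_mul]
    have : (1 / 2 - θ * n / 2) * n * u n = ∑ i ∈ Finset.range n, (1 / 2 - θ * n / 2) * u n := by
      rw [Finset.sum_const, Finset.card_range, nsmul_eq_mul]
      ring
    rw [this, ← Finset.sum_add_distrib, ← Finset.sum_sub_distrib, ← Finset.sum_sub_distrib]
    exact Finset.sum_congr rfl fun i _ => by ring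
  rw [Finset.sum_add_distrib, Finset.sum_add_distrib, ← Finset.mul_sum, ← Finset.mul_sum,
    ← Finset.mul_sum, h4] at h3
  have h5 := mul_le_mul_of_nonneg_left h0 (sub_nonneg.2 hθ)
  have h6 := mul_le_mul_of_nonneg_left h1 hθ0
  rw [hA'] at h5 h6
  nlinarith [h3, h5, h6]

/-- With `D = (n+1)/2`, averaging gives `D σ + η O ≤ -(θ - δ) K`, where `σ`, `O`, `K` are the sums
of `u - β`, of `|u - u n|` and of `κ`. Since `θ > δ(n+3)/2 = δ + D δ`, the right side pays for `(δ +
ε) K`, and `η O` pays for the absolute values. The centre `β` is fixed by `D n β = R`. -/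
theorem exists_log_decay {n : ℕ} (hn : 1 ≤ n) {θ δ : ℝ} (hδ : 0 ≤ δ)
    (hθδ : δ * ((n : ℝ) + 3) / 2 < θ) (hθ : n * θ < 1) :
    ∃ ε : ℝ, 0 < ε ∧ ∀ (u κ : ℕ → ℝ) (R : ℝ), κ 0 = 0 → (∀ j, 0 ≤ κ j) →
      (∀ j ≤ n, κ j + (∑ l ∈ Finset.range n, ∑ i ∈ Finset.range l,
          ((1 + θ) / 2 * u (i + 1) + (1 - θ) / 2 * u l)) +
        ∑ i ∈ Finset.range n, (if j ≤ i + 1 then max (u (i + 1)) (u n) else u n) ≤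
          δ * ∑ i ∈ Finset.range n, κ (i + 1) + R) →
      ∑ i ∈ Finset.range n, ((u (i + 1) - 2 * R / (n * (n + 1))) +
        ε * |u (i + 1) - 2 * R / (n * (n + 1))| + (δ + ε) * κ (i + 1)) ≤ 0 := by
  have hn0 : (0 : ℝ) < n := by exact_mod_cast hn
  have hθ0 : 0 ≤ θ := by
    have : 0 ≤ δ * ((n : ℝ) + 3) / 2 := by positivity
    linarith
  set η := (1 - n * θ) / 2 with hη
  have hη0 : 0 < η := by rw [hη]; linarith
  set D := ((n : ℝ) + 1) / 2 with hD
  have hD0 : 0 < D := by positivity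
  have hζ : 0 < θ - δ - D * δ := by rw [hD]; linarith
  have hθδ' : 0 ≤ θ - δ := by nlinarith
  set ε := min (η / (2 * D + η)) ((θ - δ - D * δ) / (θ - δ + D)) with hε
  have hε0 : 0 < ε := lt_min (by positivity) (by positivity)
  have hε1 : ε * (2 * D + η) ≤ η := (le_div_iff₀ (by positivity)).1 (min_le_left _ _)
  have hε2 : ε * (θ - δ + D) ≤ θ - δ - D * δ := (le_div_iff₀ (by positivity)).1 (min_le_right _ _)
  refine ⟨ε, hε0, fun u κ R hκ0 hκ h => ?_⟩
  have h1 := averaged_log_bound hθ0 hθ.le hκ0 h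
  set β := 2 * R / (n * (n + 1)) with hβ
  have hβR : D * (n * β) = R := by rw [hβ, hD]; field_simp
  set K := ∑ i ∈ Finset.range n, κ (i + 1)
  set O := ∑ i ∈ Finset.range n, |u (i + 1) - u n|
  set v : ℕ → ℝ := fun i => u i - β with hv
  set σ := ∑ i ∈ Finset.range n, v (i + 1) with hσ
  have hK : 0 ≤ K := Finset.sum_nonneg fun i _ => hκ _
  have hO : 0 ≤ O := Finset.sum_nonneg fun i _ => abs_nonneg _
  have hσu : ∑ i ∈ Finset.range n, u (i + 1) = σ + n * β := by
    simp [hσ, hv, Finset.sum_sub_distrib]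
  rw [hσu] at h1
  have h2 : D * σ + η * O ≤ -((θ - δ) * K) := by
    rw [← hD, ← hη] at h1
    linarith
  have hσ0 : σ ≤ 0 := by
    have h3 : D * σ ≤ 0 := by
      have := mul_nonneg hη0.le hO
      have := mul_nonneg hθδ' hK
      linarith
    by_contra hcon
    have := mul_pos hD0 (not_le.1 hcon)
    linarith
  have h4 : (n : ℝ) * |v n| ≤ O - σ := by
    have h5 : (n : ℝ) * v n = σ - ∑ i ∈ Finset.range n, (u (i + 1) - u n) := by
      simp only [hσ, hv, Finset.sum_sub_distrib, Finset.sum_const, Finset.card_range, nsmul_eq_mul]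
      ring
    have h6 : |∑ i ∈ Finset.range n, (u (i + 1) - u n)| ≤ O := Finset.abs_sum_le_sum_abs _ _
    rw [← abs_of_pos hn0, ← abs_mul, h5]
    refine (abs_sub _ _).trans ?_
    rw [abs_of_nonpos hσ0]
    linarith
  have h7 : ∑ i ∈ Finset.range n, |v (i + 1)| ≤ 2 * O - σ := by
    have h8 : ∀ i ∈ Finset.range n, |v (i + 1)| ≤ |u (i + 1) - u n| + |v n| := fun i _ => by
      have : v (i + 1) = (u (i + 1) - u n) + v n := by simp [hv]
      rw [this]
      exact abs_add_le _ _
    refine (Finset.sum_le_sum h8).trans ?_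
    rw [Finset.sum_add_distrib, Finset.sum_const, Finset.card_range, nsmul_eq_mul]
    linarith
  have h9 : ∑ i ∈ Finset.range n, ((u (i + 1) - β) + ε * |u (i + 1) - β| +
      (δ + ε) * κ (i + 1)) = σ + ε * ∑ i ∈ Finset.range n, |v (i + 1)| + (δ + ε) * K := by
    rw [Finset.sum_add_distrib, Finset.sum_add_distrib, ← Finset.mul_sum, ← Finset.mul_sum]
  rw [h9]
  have h10 : σ + ε * ∑ i ∈ Finset.range n, |v (i + 1)| + (δ + ε) * K ≤
      (1 - ε) * σ + 2 * ε * O + (δ + ε) * K := by nlinarith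
  refine h10.trans ?_
  have hε1' : ε ≤ 1 := (min_le_left _ _).trans ((div_le_one (by positivity)).2 (by linarith))
  have h11 : D * ((1 - ε) * σ + 2 * ε * O + (δ + ε) * K) ≤ 0 := by
    have h12 := mul_le_mul_of_nonneg_left h2 (sub_nonneg.2 hε1')
    have h13 : ε * (2 * D + η) * O ≤ η * O := mul_le_mul_of_nonneg_right hε1 hO
    have h14 : ε * (θ - δ + D) * K ≤ (θ - δ - D * δ) * K := mul_le_mul_of_nonneg_right hε2 hK
    nlinarith
  by_contra hcon
  have := mul_pos hD0 (not_le.1 hcon)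
  linarith

/-! ### Dyadic levels of the weight and its pointwise bound -/

/-- The points depend on `s` but not on `t`, so the kernels built from them are fixed functions on
each fibre. -/
theorem exists_level_points {I : Set ℝ} {g : ℝ → ℝ} (hI : I.OrdConnected)
    (hg : ContinuousOn g I) (hmono : StrictMonoOn g I) {s : ℝ} (hs : s ∈ I) (hpos : 0 < g s) :
    ∃ p : ℕ → ℝ, ∀ t ∈ I, s < t → ∃ k : ℕ, g t ≤ 2 ^ (k + 1) * g s ∧ p k ∈ I ∧ s ≤ p k ∧
      p k < t ∧ g (p k) = 2 ^ k * g s := by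
  classical
  -- The value `s` is a dummy for levels that are not attained; no `t` selects such a `k`.
  refine ⟨fun k => if h : ∃ p ∈ I, s ≤ p ∧ g p = 2 ^ k * g s then h.choose else s,
    fun t ht hst => ?_⟩
  have h1 : 1 < g t / g s := (one_lt_div hpos).2 (hmono hs ht hst)
  obtain ⟨z, hz1, hz2⟩ := exists_mem_Ioc_zpow (zero_lt_one.trans h1) (one_lt_two (α := ℝ))
  have hz0 : 0 ≤ z := by
    by_contra hcon
    have h3 : (2 : ℝ) ^ (z + 1) ≤ 2 ^ (0 : ℤ) := zpow_le_zpow_right₀ one_le_two (by omega)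
    rw [zpow_zero] at h3
    linarith
  obtain ⟨k, rfl⟩ := Int.eq_ofNat_of_zero_le hz0
  have hk1 : 2 ^ k * g s < g t := by
    rw [lt_div_iff₀ hpos] at hz1
    exact_mod_cast hz1
  have hk2 : g t ≤ 2 ^ (k + 1) * g s := by
    rw [div_le_iff₀ hpos] at hz2
    exact_mod_cast hz2
  have hsub : Set.Icc s t ⊆ I := hI.out hs ht
  have hone : g s ≤ 2 ^ k * g s := le_mul_of_one_le_left hpos.le (one_le_pow₀ one_le_two)
  obtain ⟨q, hq, hgq⟩ := intermediate_value_Icc hst.le (hg.mono hsub) ⟨hone, hk1.le⟩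
  have hex : ∃ p ∈ I, s ≤ p ∧ g p = 2 ^ k * g s := ⟨q, hsub hq, hq.1, hgq⟩
  obtain ⟨h3, h4, h5⟩ := hex.choose_spec
  refine ⟨k, hk2, ?_⟩
  simp only [dif_pos hex]
  refine ⟨h3, h4, ?_, h5⟩
  rw [← hmono.lt_iff_lt h3 ht, h5]
  exact hk1

theorem det_vandermonde_eq_prod_range (n : ℕ) (T : ℕ → ℝ) :
    (Matrix.vandermonde fun i : Fin n => T i).det =
      ∏ l ∈ Finset.range n, ∏ i ∈ Finset.range l, (T l - T i) := by
  rw [Matrix.det_vandermonde, Finset.prod_range,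
    Finset.prod_comm' (s' := fun j => Finset.Iio j) (t' := Finset.univ) (by simp)]
  refine Finset.prod_congr rfl fun j _ => ?_
  rw [← Nat.Iio_eq_range, ← Fin.map_valEmbedding_Iio, Finset.prod_map]
  rfl

/-- The interval from `T i` to `T l` contains both the gap after `T i` and the gap before `T l`, so
its log-length dominates any convex combination of theirs. -/
theorem log_vandermonde_lower_bound {n : ℕ} {θ : ℝ} (hθ0 : 0 ≤ θ) (hθ1 : θ ≤ 1) {T w : ℕ → ℝ}
    (hT : ∀ i l, i < l → l < n → T i < T l) (hw0 : ∀ i < n, 0 < w (i + 1))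
    (hw : ∀ i < n, w (i + 1) ≤ T (i + 1) - T i) :
    ∑ l ∈ Finset.range n, ∑ i ∈ Finset.range l,
      ((1 + θ) / 2 * Real.log (w (i + 1)) + (1 - θ) / 2 * Real.log (w l)) ≤
    Real.log (∏ l ∈ Finset.range n, ∏ i ∈ Finset.range l, (T l - T i)) := by
  rw [Real.log_prod fun l hl => Finset.prod_ne_zero_iff.2 fun i hi =>
    (sub_pos.2 (hT i l (Finset.mem_range.1 hi) (Finset.mem_range.1 hl))).ne']
  refine Finset.sum_le_sum fun l hl => ?_
  have hl := Finset.mem_range.1 hl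
  rw [Real.log_prod fun i hi => (sub_pos.2 (hT i l (Finset.mem_range.1 hi) hl)).ne']
  refine Finset.sum_le_sum fun i hi => ?_
  have hi := Finset.mem_range.1 hi
  have hle : ∀ i l, i ≤ l → l < n → T i ≤ T l := fun i l h h' =>
    h.eq_or_lt.elim (fun h => h ▸ le_rfl) fun h => (hT i l h h').le
  have h1 : Real.log (w (i + 1)) ≤ Real.log (T l - T i) :=
    Real.log_le_log (hw0 i (by omega))
      ((hw i (by omega)).trans (sub_le_sub_right (hle (i + 1) l hi hl) _))
  have h2 : Real.log (w l) ≤ Real.log (T l - T i) := by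
    obtain ⟨m, rfl⟩ : ∃ m, l = m + 1 := ⟨l - 1, by omega⟩
    exact Real.log_le_log (hw0 m (by omega))
      ((hw m (by omega)).trans (sub_le_sub_left (hle i m (by omega) (by omega)) _))
  have h3 := mul_le_mul_of_nonneg_left h1 (by linarith : 0 ≤ (1 + θ) / 2)
  have h4 := mul_le_mul_of_nonneg_left h2 (by linarith : 0 ≤ (1 - θ) / 2)
  linarith

/-- On the set where the Jacobian is at most `exp L` times the product of the `ω (t i) ^ δ`, this
product is bounded by a product of functions of consecutive pairs of coordinates. -/
theorem exists_log_weight_bound {n : ℕ} (hn : 1 ≤ n) {θ δ : ℝ} (hδ : 0 ≤ δ)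
    (hθδ : δ * ((n : ℝ) + 3) / 2 < θ) (hθ : n * θ < 1) :
    ∃ ε : ℝ, 0 < ε ∧ ∃ c : ℝ, ∀ (f : ℕ → ℝ → ℝ) (I : Set ℝ), IsDerivChain n f I →
      ∀ s ∈ I, ∃ p : ℕ → ℝ, ∀ t : Fin (n + 1) → ℝ, StrictMono t → (∀ i, t i ∈ I) → t 0 = s →
      ∀ L β : ℝ,
        β = 2 * (L + δ * n * (Real.log 2 + Real.log (f (n + 1) s)) -
          Real.log (f (n + 1) s) + c) / (n * (n + 1)) →
        Real.log (curveJacobian n f t).det ≤ L + δ * ∑ i : Fin n, Real.log (f (n + 1) (t i.succ)) →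
        ∃ k : Fin n → ℕ, (∀ i, max (t i.castSucc) (p (k i)) < t i.succ) ∧
          δ * ∑ i : Fin n, Real.log (f (n + 1) (t i.succ)) ≤
            δ * n * (Real.log 2 + Real.log (f (n + 1) s)) -
            ∑ i : Fin n, ((Real.log (t i.succ - max (t i.castSucc) (p (k i))) - β) +
              ε * |Real.log (t i.succ - max (t i.castSucc) (p (k i))) - β| +
              ε * (k i * Real.log 2)) := by
  obtain ⟨ε, hε, hdecay⟩ := exists_log_decay hn hδ hθδ hθ
  obtain ⟨c, hc, hJ⟩ := det_curveJacobian_lower_bound n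
  have hn1 : (1 : ℝ) ≤ n := by exact_mod_cast hn
  have hθ0 : 0 ≤ θ := by
    have : 0 ≤ δ * ((n : ℝ) + 3) / 2 := by positivity
    linarith
  have hθ1 : θ ≤ 1 := by nlinarith
  refine ⟨ε, hε, -Real.log c, fun f I hf s hs => ?_⟩
  have hω0 := hf.pos s hs
  obtain ⟨p, hp⟩ := exists_level_points hf.ordConnected hf.continuousOn hf.strictMonoOn hs hω0
  refine ⟨p, fun t ht htI hts L β hβ hLJ => ?_⟩
  have hk : ∀ i : Fin n, ∃ k : ℕ, f (n + 1) (t i.succ) ≤ 2 ^ (k + 1) * f (n + 1) s ∧ p k ∈ I ∧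
      s ≤ p k ∧ p k < t i.succ ∧ f (n + 1) (p k) = 2 ^ k * f (n + 1) s := fun i =>
    hp _ (htI _) (hts ▸ ht (Fin.succ_pos i))
  choose k hk1 hk2 hk3 hk4 hk5 using hk
  refine ⟨k, fun i => max_lt (ht Fin.castSucc_lt_succ) (hk4 i), ?_⟩
  -- Extensions to sequences indexed by all natural numbers.
  set T : ℕ → ℝ := fun i => if h : i < n + 1 then t ⟨i, h⟩ else 0 with hT
  -- Index `0` supplies the extra threshold `s`, at level `0`.
  set kk : ℕ → ℕ := fun j => if h : 0 < j ∧ j ≤ n then k ⟨j - 1, by omega⟩ else 0 with hkk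
  set q : ℕ → ℝ := fun j => if h : 0 < j ∧ j ≤ n then p (k ⟨j - 1, by omega⟩) else s with hq
  set w : ℕ → ℝ := fun j => T j - max (T (j - 1)) (q j) with hw
  have hTs : ∀ i : Fin n, T ((i : ℕ) + 1) = t i.succ := fun i => by
    have h : (i : ℕ) + 1 < n + 1 := by omega
    simp only [hT, h, dif_pos]
    rfl
  have hTc : ∀ i : Fin n, T (i : ℕ) = t i.castSucc := fun i => by
    have h : (i : ℕ) < n + 1 := by omega
    simp only [hT, h, dif_pos]
    rfl
  have hkks : ∀ i : Fin n, kk ((i : ℕ) + 1) = k i := fun i => by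
    have h : (i : ℕ) + 1 ≤ n := by omega
    simp [hkk, h]
  have hqs : ∀ i : Fin n, q ((i : ℕ) + 1) = p (k i) := fun i => by
    have h : (i : ℕ) + 1 ≤ n := by omega
    simp [hq, h]
  have hws : ∀ i : Fin n, w ((i : ℕ) + 1) = t i.succ - max (t i.castSucc) (p (k i)) := fun i => by
    simp only [hw, hTs, hqs, Nat.add_sub_cancel, hTc]
  have hTn : T n = t (Fin.last n) := by
    simp only [hT, Nat.lt_succ_self, dif_pos]
    rfl
  have hTlt : ∀ i l, i < l → l ≤ n → T i < T l := by
    intro i l h h'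
    have h1 : i < n + 1 := by omega
    have h2 : l < n + 1 := by omega
    simp only [hT, h1, h2, dif_pos]
    exact ht h
  have hTle : ∀ i l, i ≤ l → l ≤ n → T i ≤ T l := fun i l h h' =>
    h.eq_or_lt.elim (fun h => h ▸ le_rfl) fun h => (hTlt i l h h').le
  have hqI : ∀ j ≤ n, q j ∈ I := by
    intro j hj
    rcases Nat.eq_zero_or_pos j with rfl | h
    · simpa [hq] using hs
    · simp only [hq, h, hj, and_self, dif_pos]
      exact hk2 _
  have hωq : ∀ j ≤ n, f (n + 1) (q j) = 2 ^ kk j * f (n + 1) s := by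
    intro j hj
    rcases Nat.eq_zero_or_pos j with rfl | h
    · simp [hq, hkk]
    · simp only [hq, hkk, h, hj, and_self, dif_pos]
      exact hk5 _
  have hkkle : ∀ i j, i ≤ j → j ≤ n → kk i ≤ kk j := by
    intro i j hij hj
    rcases Nat.eq_zero_or_pos i with rfl | h
    · simp [hkk]
    · obtain ⟨i', rfl⟩ : ∃ i' : Fin n, i = (i' : ℕ) + 1 := ⟨⟨i - 1, by omega⟩, by simp; omega⟩
      obtain ⟨j', rfl⟩ : ∃ j' : Fin n, j = (j' : ℕ) + 1 := ⟨⟨j - 1, by omega⟩, by simp; omega⟩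
      rw [hkks, hkks]
      have h1 : f (n + 1) (p (k i')) < f (n + 1) (t i'.succ) :=
        hf.strictMonoOn (hk2 i') (htI _) (hk4 i')
      have h2 : f (n + 1) (t i'.succ) ≤ f (n + 1) (t j'.succ) :=
        hf.strictMonoOn.monotoneOn (htI _) (htI _)
          (ht.monotone (Fin.succ_le_succ_iff.2 (Fin.le_def.2 (by omega))))
      have h3 := h1.trans_le (h2.trans (hk1 j'))
      rw [hk5, mul_lt_mul_iff_left₀ hω0] at h3
      exact Nat.lt_succ_iff.1 ((pow_lt_pow_iff_right₀ one_lt_two).1 h3)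
  have hqle : ∀ i j, i ≤ j → j ≤ n → q i ≤ q j := by
    intro i j hij hj
    rw [← hf.strictMonoOn.le_iff_le (hqI i (hij.trans hj)) (hqI j hj), hωq i (hij.trans hj),
      hωq j hj]
    exact mul_le_mul_of_nonneg_right (pow_le_pow_right₀ one_le_two (hkkle i j hij hj)) hω0.le
  have hw0 : ∀ i < n, 0 < w (i + 1) := fun i hi => by
    have h1 := hws ⟨i, hi⟩
    simp only at h1
    rw [h1]
    exact sub_pos.2 (max_lt (ht Fin.castSucc_lt_succ) (hk4 _))
  have hwn : 0 < w n := by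
    obtain ⟨m, rfl⟩ : ∃ m, n = m + 1 := ⟨n - 1, by omega⟩
    exact hw0 m (by omega)
  have hV0 : 0 < ∏ l ∈ Finset.range n, ∏ i ∈ Finset.range l, (T l - T i) :=
    Finset.prod_pos fun l hl => Finset.prod_pos fun i hi =>
      sub_pos.2 (hTlt i l (Finset.mem_range.1 hi) (Finset.mem_range.1 hl).le)
  have hlogV := log_vandermonde_lower_bound hθ0 hθ1 (fun i l h h' => hTlt i l h h'.le) hw0
    (fun i _ => sub_le_sub_left (le_max_left _ _) _)
  have hω : ∀ i : Fin n, Real.log (f (n + 1) (t i.succ)) ≤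
      k i * Real.log 2 + (Real.log 2 + Real.log (f (n + 1) s)) := fun i => by
    refine (Real.log_le_log (hf.pos _ (htI _)) (hk1 i)).trans (le_of_eq ?_)
    rw [Real.log_mul (by positivity) hω0.ne', Real.log_pow]
    push_cast
    ring
  set κ : ℕ → ℝ := fun j => kk j * Real.log 2 with hκ
  have hsumκ : ∑ i ∈ Finset.range n, κ (i + 1) = ∑ i : Fin n, k i * Real.log 2 := by
    rw [Finset.sum_range]
    exact Finset.sum_congr rfl fun i _ => by rw [hκ]; simp only [hkks]
  have hωsum : δ * ∑ i : Fin n, Real.log (f (n + 1) (t i.succ)) ≤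
      δ * ∑ i ∈ Finset.range n, κ (i + 1) +
        δ * n * (Real.log 2 + Real.log (f (n + 1) s)) := by
    rw [hsumκ, mul_assoc, ← mul_add]
    refine mul_le_mul_of_nonneg_left ((Finset.sum_le_sum fun i _ => hω i).trans (le_of_eq ?_)) hδ
    rw [Finset.sum_add_distrib, Finset.sum_const, Finset.card_univ, Fintype.card_fin, nsmul_eq_mul]
  have key := hdecay (fun j => Real.log (w j)) κ (L + δ * n * (Real.log 2 +
    Real.log (f (n + 1) s)) - Real.log (f (n + 1) s) + -Real.log c) (by simp [hκ, hkk])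
    (fun j => mul_nonneg (Nat.cast_nonneg _) (Real.log_nonneg one_le_two)) (by
      intro j hj
      have hqn : q j < T n := by
        refine (hqle j n hj le_rfl).trans_lt ?_
        have := hwn
        simp only [hw, sub_pos] at this
        exact (le_max_right _ _).trans_lt this
      have h1 := hJ f I hf t ht htI (q j) (2 ^ kk j * f (n + 1) s) (hTn ▸ hqn) (by positivity)
        (fun x hx hqx => (hωq j hj) ▸ hf.strictMonoOn.monotoneOn (hqI j hj) hx hqx)
      have h2 : (Matrix.vandermonde fun i : Fin n => t i.castSucc).det =
          ∏ l ∈ Finset.range n, ∏ i ∈ Finset.range l, (T l - T i) := by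
        rw [← det_vandermonde_eq_prod_range]
        simp only [hTc]
      have h3 : ∏ i : Fin n, (t (Fin.last n) - max (t i.castSucc) (q j)) =
          ∏ i ∈ Finset.range n, (T n - max (T i) (q j)) := by
        rw [Finset.prod_range]
        simp only [hTc, hTn]
      have h4 : ∀ i < n, 0 < T n - max (T i) (q j) := fun i hi =>
        sub_pos.2 (max_lt (hTlt i n hi le_rfl) hqn)
      have h5 : 0 < ∏ i ∈ Finset.range n, (T n - max (T i) (q j)) :=
        Finset.prod_pos fun i hi => h4 i (Finset.mem_range.1 hi)
      rw [h2, h3] at h1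
      have h6 := (Real.log_le_log (by positivity) h1).trans hLJ
      rw [Real.log_mul (by positivity) h5.ne', Real.log_mul (by positivity) hV0.ne',
        Real.log_mul hc.ne' (by positivity), Real.log_mul (by positivity) hω0.ne', Real.log_pow,
        Real.log_prod fun i hi => (h4 i (Finset.mem_range.1 hi)).ne'] at h6
      -- The interval from `max (T i) (q j)` to `T n` always contains the one of length `w n`, and
      -- for `j ≤ i + 1` also the one of length `w (i + 1)`.
      have h7 : ∑ i ∈ Finset.range n, (if j ≤ i + 1 then max (Real.log (w (i + 1)))
          (Real.log (w n)) else Real.log (w n)) ≤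
          ∑ i ∈ Finset.range n, Real.log (T n - max (T i) (q j)) := by
        refine Finset.sum_le_sum fun i hi => ?_
        have hi := Finset.mem_range.1 hi
        have h8 : Real.log (w n) ≤ Real.log (T n - max (T i) (q j)) :=
          Real.log_le_log hwn (sub_le_sub_left
            (max_le_max (hTle i (n - 1) (by omega) (by omega)) (hqle j n hj le_rfl)) _)
        split_ifs with hji
        · refine max_le (Real.log_le_log (hw0 i hi) ?_) h8
          exact sub_le_sub (hTle (i + 1) n hi le_rfl)
            (max_le_max le_rfl (hqle j (i + 1) hji hi))
        · exact h8
      simp only [hκ] at hωsum ⊢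
      linarith)
  rw [← hβ, Finset.sum_range] at key
  have h9 : ∑ i : Fin n, ((Real.log (w ((i : ℕ) + 1)) - β) +
      ε * |Real.log (w ((i : ℕ) + 1)) - β| + (δ + ε) * κ ((i : ℕ) + 1)) =
      ∑ i : Fin n, ((Real.log (t i.succ - max (t i.castSucc) (p (k i))) - β) +
        ε * |Real.log (t i.succ - max (t i.castSucc) (p (k i))) - β| + ε * (k i * Real.log 2)) +
      δ * ∑ i ∈ Finset.range n, κ (i + 1) := by
    rw [hsumκ, Finset.mul_sum, ← Finset.sum_add_distrib]
    refine Finset.sum_congr rfl fun i _ => ?_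
    simp only [hws, hκ, hkks]
    ring
  rw [h9] at key
  linarith

/-! ### Integration of products of kernels -/

theorem lintegral_pi_fin_succ {n : ℕ} {H : (Fin (n + 1) → ℝ) → ℝ≥0∞} (hH : Measurable H) :
    ∫⁻ t, H t = ∫⁻ x : ℝ, ∫⁻ v : Fin n → ℝ, H (Fin.cons x v) := by
  have h1 := (volume_preserving_piFinSuccAbove (fun _ : Fin (n + 1) => ℝ) 0).symm
  have h2 : ∀ z : ℝ × (Fin n → ℝ),
      (MeasurableEquiv.piFinSuccAbove (fun _ : Fin (n + 1) => ℝ) 0).symm z = Fin.cons z.1 z.2 :=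
    fun z => Fin.insertNth_zero' z.1 z.2
  rw [← h1.lintegral_comp hH, Measure.volume_eq_prod]
  refine (lintegral_prod _ (hH.comp h1.measurable).aemeasurable).trans ?_
  exact lintegral_congr fun x => lintegral_congr fun v => congrArg H (h2 (x, v))

theorem measurable_cons {n : ℕ} (x : ℝ) :
    Measurable fun v : Fin n → ℝ => (Fin.cons x v : Fin (n + 1) → ℝ) := by
  rw [measurable_pi_iff]
  intro i
  induction i using Fin.cases with
  | zero => simp
  | succ i => simpa using measurable_pi_apply i

/-- The integral of a product of functions of consecutive pairs of coordinates. -/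
theorem lintegral_prod_consecutive_le {g : ℝ → ℝ → ℝ≥0∞} (hg : Measurable (Function.uncurry g))
    {A : ℝ≥0∞} (hA : ∀ x, ∫⁻ y, g x y ≤ A) (n : ℕ) :
    ∀ x : ℝ, ∫⁻ v : Fin n → ℝ,
      ∏ i : Fin n, g ((Fin.cons x v : Fin (n + 1) → ℝ) i.castSucc) (v i) ≤ A ^ n := by
  induction n with
  | zero =>
    intro x
    simp [volume_pi]
  | succ n ih =>
    intro x
    have hmeas : ∀ (m : ℕ) (x : ℝ), Measurable fun v : Fin m → ℝ =>
        ∏ i : Fin m, g ((Fin.cons x v : Fin (m + 1) → ℝ) i.castSucc) (v i) := fun m x =>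
      Finset.measurable_fun_prod _ fun i _ => hg.comp
        (((measurable_pi_apply i.castSucc).comp (measurable_cons x)).prodMk (measurable_pi_apply i))
    rw [lintegral_pi_fin_succ (hmeas _ x)]
    have h1 : ∀ (y : ℝ) (v : Fin n → ℝ), ∏ i : Fin (n + 1),
        g ((Fin.cons x (Fin.cons y v : Fin (n + 1) → ℝ) : Fin (n + 2) → ℝ) i.castSucc)
          ((Fin.cons y v : Fin (n + 1) → ℝ) i) =
        g x y * ∏ i : Fin n, g ((Fin.cons y v : Fin (n + 1) → ℝ) i.castSucc) (v i) := by
      intro y v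
      rw [Fin.prod_univ_succ]
      simp only [Fin.castSucc_zero, Fin.cons_zero, Fin.cons_succ, ← Fin.succ_castSucc]
    simp only [h1]
    calc _ = ∫⁻ y, g x y * ∫⁻ v : Fin n → ℝ,
          ∏ i : Fin n, g ((Fin.cons y v : Fin (n + 1) → ℝ) i.castSucc) (v i) :=
          lintegral_congr fun y => lintegral_const_mul _ (hmeas n y)
      _ ≤ ∫⁻ y, g x y * A ^ n := lintegral_mono fun y => by gcongr; exact ih y
      _ = (∫⁻ y, g x y) * A ^ n :=
          lintegral_mul_const _ (hg.comp (measurable_const.prodMk measurable_id))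
      _ ≤ A * A ^ n := by gcongr; exact hA x
      _ = A ^ (n + 1) := by rw [pow_succ, mul_comm]

/-- The function `z ↦ min (z ^ (-1 - ε)) (z ^ (-1 + ε))` on the positive half-line. -/
noncomputable def decayFun (ε z : ℝ) : ℝ≥0∞ :=
  if 0 < z then ENNReal.ofReal (Real.exp (-(Real.log z + ε * |Real.log z|))) else 0

theorem measurable_decayFun (ε : ℝ) : Measurable (decayFun ε) := by
  unfold decayFun
  refine Measurable.ite measurableSet_Ioi ?_ measurable_const
  have := Real.measurable_log
  fun_prop

/-- The gain `ε |log z|` makes `1/z` integrable at both ends. -/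
theorem lintegral_decayFun_lt_top {ε : ℝ} (hε : 0 < ε) : ∫⁻ z, decayFun ε z < ∞ := by
  have h1 : ∫⁻ z in Set.Ioc (0 : ℝ) 1, ENNReal.ofReal (z ^ (ε - 1)) < ∞ := by
    have h : IntegrableOn (fun z : ℝ => z ^ (ε - 1)) (Set.Ioc 0 1) volume :=
      (intervalIntegrable_iff_integrableOn_Ioc_of_le zero_le_one).1
        (intervalIntegral.intervalIntegrable_rpow' (by linarith))
    exact h.lintegral_lt_top
  have h2 : ∫⁻ z in Set.Ioi (1 : ℝ), ENNReal.ofReal (z ^ (-ε - 1)) < ∞ :=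
    (integrableOn_Ioi_rpow_of_lt (by linarith : -ε - 1 < -1) one_pos).lintegral_lt_top
  refine lt_of_le_of_lt ?_ (ENNReal.add_lt_top.2 ⟨h1, h2⟩)
  rw [← lintegral_indicator measurableSet_Ioc, ← lintegral_indicator measurableSet_Ioi,
    ← lintegral_add_left ((by fun_prop : Measurable fun z : ℝ =>
      ENNReal.ofReal (z ^ (ε - 1))).indicator measurableSet_Ioc)]
  refine lintegral_mono fun z => ?_
  unfold decayFun
  split_ifs with hz
  · rcases le_or_gt z 1 with h | h
    · rw [Set.indicator_of_mem (s := Set.Ioc (0 : ℝ) 1) ⟨hz, h⟩, abs_of_nonpos (Real.log_nonpos hz.le h),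
        Real.rpow_def_of_pos hz]
      refine le_trans (le_of_eq ?_) le_self_add
      congr 2
      ring
    · rw [Set.indicator_of_mem (s := Set.Ioi (1 : ℝ)) h, abs_of_nonneg (Real.log_nonneg h.le),
        Real.rpow_def_of_pos hz]
      refine le_trans (le_of_eq ?_) le_add_self
      congr 2
      ring
  · exact zero_le

/-- The kernel `(x, y) ↦ ∑' k, 2 ^ (-ε k) decayFun ε (exp (-β) (y - max x (p k)))`. -/
noncomputable def levelKernel (ε β : ℝ) (p : ℕ → ℝ) (x y : ℝ) : ℝ≥0∞ :=
  ∑' k : ℕ, ENNReal.ofReal (Real.exp (-(ε * (k * Real.log 2)))) *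
    decayFun ε ((y - max x (p k)) * Real.exp (-β))

theorem measurable_levelKernel (ε β : ℝ) (p : ℕ → ℝ) :
    Measurable (Function.uncurry (levelKernel ε β p)) := by
  unfold levelKernel Function.uncurry
  refine Measurable.tsum fun k => Measurable.const_mul ((measurable_decayFun ε).comp ?_) _
  fun_prop

/-- The level `k` varies with the tuple; summing over all levels makes one kernel dominate every
case. -/
theorem ofReal_exp_le_levelKernel {p : ℕ → ℝ} {k : ℕ} {x y : ℝ} (h : max x (p k) < y)
    (ε β : ℝ) :
    ENNReal.ofReal (Real.exp (-((Real.log (y - max x (p k)) - β) +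
      ε * |Real.log (y - max x (p k)) - β| + ε * (k * Real.log 2)))) ≤ levelKernel ε β p x y := by
  refine le_trans (le_of_eq ?_) (ENNReal.le_tsum k)
  have h1 : 0 < y - max x (p k) := sub_pos.2 h
  rw [decayFun, if_pos (mul_pos h1 (Real.exp_pos _)), ← ENNReal.ofReal_mul (Real.exp_pos _).le,
    ← Real.exp_add, Real.log_mul h1.ne' (Real.exp_pos _).ne', Real.log_exp]
  congr 2
  simp only [← sub_eq_add_neg]
  ring

/-- Translation invariance eliminates `x` and `p k`, and scaling produces `exp β`, so the integral
does not depend on `x`. -/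
theorem lintegral_levelKernel (ε β : ℝ) (p : ℕ → ℝ) (x : ℝ) :
    ∫⁻ y, levelKernel ε β p x y =
      (∑' k : ℕ, ENNReal.ofReal (Real.exp (-(ε * (k * Real.log 2))))) * ∫⁻ z, decayFun ε z *
        ENNReal.ofReal (Real.exp β) := by
  have hm : ∀ k, Measurable fun y => decayFun ε ((y - max x (p k)) * Real.exp (-β)) := fun k =>
    (measurable_decayFun ε).comp (by fun_prop)
  have h1 : ∀ k, ∫⁻ y, decayFun ε ((y - max x (p k)) * Real.exp (-β)) =
      ∫⁻ z, decayFun ε z * ENNReal.ofReal (Real.exp β) := by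
    intro k
    rw [lintegral_sub_right_eq_self (fun y => decayFun ε (y * Real.exp (-β))),
      ← lintegral_map (g := fun y => y * Real.exp (-β)) (measurable_decayFun ε)
        (measurable_id.mul_const _), Real.map_volume_mul_right (Real.exp_pos _).ne', lintegral_smul_measure,
      lintegral_mul_const _ (measurable_decayFun ε), mul_comm, ← Real.exp_neg, neg_neg,
      abs_of_pos (Real.exp_pos _)]
    rfl
  unfold levelKernel
  rw [lintegral_tsum fun k => ((hm k).const_mul _).aemeasurable, ← ENNReal.tsum_mul_right]
  exact tsum_congr fun k => by rw [lintegral_const_mul _ (hm k), h1]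

theorem tsum_exp_neg_lt_top {ε : ℝ} (hε : 0 < ε) :
    ∑' k : ℕ, ENNReal.ofReal (Real.exp (-(ε * (k * Real.log 2)))) < ∞ := by
  have h1 : Real.exp (-(ε * Real.log 2)) < 1 := by
    rw [Real.exp_lt_one_iff]
    have := mul_pos hε (Real.log_pos one_lt_two)
    linarith
  have h2 : ∀ k : ℕ, ENNReal.ofReal (Real.exp (-(ε * (k * Real.log 2)))) =
      ENNReal.ofReal (Real.exp (-(ε * Real.log 2))) ^ k := fun k => by
    rw [← ENNReal.ofReal_pow (Real.exp_pos _).le, ← Real.exp_nat_mul]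
    congr 2
    ring
  simp only [h2]
  rw [ENNReal.tsum_geometric, ENNReal.inv_lt_top, tsub_pos_iff_lt]
  simpa using h1

/-! ### Sublevel sets and the estimate on a fibre -/

/-- The `n`-tuples which, together with the first coordinate `s`, form a strictly increasing tuple
in `I`. -/
def increasingRegion (n : ℕ) (I : Set ℝ) (s : ℝ) : Set (Fin n → ℝ) :=
  {v | StrictMono (Fin.cons s v : Fin (n + 1) → ℝ) ∧ ∀ i, (Fin.cons s v : Fin (n + 1) → ℝ) i ∈ I}

/-- The sublevel set estimate for the quotient of the Jacobian and the weight. -/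
theorem lintegral_weight_sublevel_le {n : ℕ} (hn : 1 ≤ n) {δ : ℝ}
    (hδ : δ = 2 / (((n : ℝ) + 1) * (n + 2))) :
    ∃ C : ℝ≥0, ∀ (f : ℕ → ℝ → ℝ) (I : Set ℝ), IsDerivChain n f I → ∀ s ∈ I, ∀ L : ℝ,
      ∫⁻ v in {v | v ∈ increasingRegion n I s ∧
          Real.log (curveJacobian n f (Fin.cons s v)).det ≤
            L + δ * ∑ i, Real.log (f (n + 1) (v i))},
        ENNReal.ofReal (Real.exp (δ * ∑ i, Real.log (f (n + 1) (v i)))) ≤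
      C * ENNReal.ofReal (Real.exp (2 / (n + 1) * (L - δ * Real.log (f (n + 1) s)))) := by
  have hn1 : (1 : ℝ) ≤ n := by exact_mod_cast hn
  have hn0 : (0 : ℝ) < n := by linarith
  have hδ0 : 0 ≤ δ := by rw [hδ]; positivity
  -- Room for `θ` exists because `n(n+3) < (n+1)(n+2)`.
  obtain ⟨θ, hθ1, hθ2⟩ : ∃ θ : ℝ, δ * ((n : ℝ) + 3) / 2 < θ ∧ θ < 1 / n := by
    refine exists_between ?_
    rw [hδ, div_mul_eq_mul_div, div_div, div_lt_div_iff₀ (by positivity) hn0]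
    nlinarith
  have hθ : n * θ < 1 := by rwa [lt_div_iff₀' hn0] at hθ2
  obtain ⟨ε, hε, c, H⟩ := exists_log_weight_bound hn hδ0 hθ1 hθ
  set S := ∑' k : ℕ, ENNReal.ofReal (Real.exp (-(ε * (k * Real.log 2)))) with hS
  have hSlt : S < ∞ := tsum_exp_neg_lt_top hε
  set M := ∫⁻ z, decayFun ε z with hM
  have hMlt : M < ∞ := lintegral_decayFun_lt_top hε
  set B := (S * M) ^ n * ENNReal.ofReal (Real.exp (δ * n * Real.log 2 +
    2 / (n + 1) * (δ * n * Real.log 2 + c))) with hB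
  have hBlt : B < ∞ := ENNReal.mul_lt_top (ENNReal.pow_lt_top (ENNReal.mul_lt_top hSlt hMlt))
    ENNReal.ofReal_lt_top
  refine ⟨B.toNNReal, fun f I hf s hs L => ?_⟩
  rw [ENNReal.coe_toNNReal hBlt.ne]
  obtain ⟨p, hp⟩ := H f I hf s hs
  set ℓ := Real.log (f (n + 1) s) with hℓ
  set β := 2 * (L + δ * n * (Real.log 2 + ℓ) - ℓ + c) / (n * (n + 1)) with hβ
  calc _ ≤ ∫⁻ v : Fin n → ℝ, ENNReal.ofReal (Real.exp (δ * n * (Real.log 2 + ℓ))) *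
        ∏ i : Fin n, levelKernel ε β p ((Fin.cons s v : Fin (n + 1) → ℝ) i.castSucc) (v i) := by
        refine (setLIntegral_mono ?_ fun v hv => ?_).trans (setLIntegral_le_lintegral _ _)
        · exact measurable_const.mul (Finset.measurable_fun_prod _ fun i _ =>
            (measurable_levelKernel ε β p).comp
              (((measurable_pi_apply i.castSucc).comp (measurable_cons s)).prodMk
                (measurable_pi_apply i)))
        obtain ⟨k, hk1, hk2⟩ := hp (Fin.cons s v) hv.1.1 hv.1.2 (Fin.cons_zero _ _) L β hβ
          (by simpa only [Fin.cons_succ] using hv.2)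
        simp only [Fin.cons_succ] at hk1 hk2
        refine (ENNReal.ofReal_le_ofReal (Real.exp_le_exp.2 hk2)).trans ?_
        rw [sub_eq_add_neg, Real.exp_add, ENNReal.ofReal_mul (Real.exp_pos _).le,
          ← Finset.sum_neg_distrib, Real.exp_sum,
          ENNReal.ofReal_prod_of_nonneg fun i _ => (Real.exp_pos _).le]
        gcongr with i
        refine le_trans (le_of_eq ?_) (ofReal_exp_le_levelKernel (hk1 i) ε β)
        ring_nf
    _ ≤ ENNReal.ofReal (Real.exp (δ * n * (Real.log 2 + ℓ))) *
        (S * (M * ENNReal.ofReal (Real.exp β))) ^ n := by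
        rw [lintegral_const_mul']
        · gcongr
          refine lintegral_prod_consecutive_le (measurable_levelKernel ε β p) (fun x => ?_) n s
          rw [lintegral_levelKernel, lintegral_mul_const _ (measurable_decayFun ε)]
        · exact ENNReal.ofReal_ne_top
    _ = B * ENNReal.ofReal (Real.exp (2 / (n + 1) * (L - δ * ℓ))) := by
        have h1 : (S * (M * ENNReal.ofReal (Real.exp β))) ^ n =
            (S * M) ^ n * ENNReal.ofReal (Real.exp (n * β)) := by
          rw [← mul_assoc, mul_pow, ← ENNReal.ofReal_pow (Real.exp_pos _).le, ← Real.exp_nat_mul]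
        rw [h1, hB, mul_left_comm, mul_assoc ((S * M) ^ n), ← ENNReal.ofReal_mul (Real.exp_pos _).le,
          ← ENNReal.ofReal_mul (Real.exp_pos _).le, ← Real.exp_add, ← Real.exp_add]
        congr 3
        -- The exponents of `f (n + 1) s` agree exactly because `δ (n+1)(n+2) = 2`.
        rw [hβ, hδ]
        field_simp
        ring

/-- With `x = m/(2D)` the first term is at most `m/2` and is absorbed. Taking `D = C + 1` keeps the
divisor positive when `C = 0`. -/
theorem exists_rpow_le_of_forall_le_add {r : ℝ} (hr : 0 < r) (C : ℝ≥0) :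
    ∃ C' : ℝ≥0, ∀ m Y : ℝ≥0∞,
      (∀ x : ℝ, 0 < x → m ≤ C * ENNReal.ofReal x + ENNReal.ofReal (x ^ (-r)) * Y) →
        m ^ (r + 1) ≤ C' * Y := by
  set D : ℝ := C + 1 with hD
  have hD0 : 0 < D := by positivity
  refine ⟨Real.toNNReal (2 * (2 * D) ^ r), fun m Y h => ?_⟩
  rcases eq_or_ne Y ∞ with rfl | hY
  · have h1 : (0 : ℝ) < 2 * (2 * D) ^ r := by positivity
    rw [ENNReal.mul_top (by simpa using h1)]
    exact le_top
  have hm : m ≠ ∞ := by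
    refine ne_top_of_le_ne_top ?_ (h 1 one_pos)
    exact ENNReal.add_ne_top.2 ⟨ENNReal.mul_ne_top ENNReal.coe_ne_top ENNReal.ofReal_ne_top,
      ENNReal.mul_ne_top ENNReal.ofReal_ne_top hY⟩
  rcases eq_or_ne m 0 with rfl | hm0
  · rw [ENNReal.zero_rpow_of_pos (by linarith)]
    exact zero_le
  lift m to ℝ≥0 using hm
  lift Y to ℝ≥0 using hY
  have hm1 : (0 : ℝ) < m := by
    have : m ≠ 0 := by exact_mod_cast hm0
    exact_mod_cast pos_iff_ne_zero.2 this
  have h1 := h (m / (2 * D)) (by positivity)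
  rw [← ENNReal.toReal_le_toReal (by finiteness) (by finiteness),
    ENNReal.toReal_add (by finiteness) (by finiteness)] at h1
  simp only [ENNReal.toReal_mul, ENNReal.coe_toReal] at h1
  rw [ENNReal.toReal_ofReal (by positivity), ENNReal.toReal_ofReal (by positivity)] at h1
  have h2 : (C : ℝ) * (m / (2 * D)) ≤ m / 2 := by
    rw [mul_div_assoc', div_le_div_iff₀ (by positivity) two_pos]
    have : (C : ℝ) ≤ D := by rw [hD]; linarith
    nlinarith
  have h3 : ((m : ℝ) / (2 * D)) ^ (-r) = (2 * D) ^ r / (m : ℝ) ^ r := by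
    rw [Real.rpow_neg (by positivity), Real.div_rpow hm1.le (by positivity), inv_div]
  rw [h3] at h1
  have h4 : (m : ℝ) ^ (r + 1) ≤ 2 * (2 * D) ^ r * Y := by
    rw [Real.rpow_add_one hm1.ne']
    have h5 : (0 : ℝ) < (m : ℝ) ^ r := by positivity
    have h6 : (m : ℝ) / 2 ≤ (2 * D) ^ r / (m : ℝ) ^ r * Y := by linarith
    rw [div_mul_eq_mul_div, le_div_iff₀ h5] at h6
    linarith
  rw [← ENNReal.toReal_le_toReal (by finiteness) (by finiteness)]
  rw [← ENNReal.toReal_rpow, ENNReal.toReal_mul, ENNReal.coe_toReal, ENNReal.coe_toReal,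
    ENNReal.coe_toReal, Real.coe_toNNReal _ (by positivity)]
  exact h4

/-- The estimate on the fibre over a fixed first coordinate `s`. -/
theorem rpow_lintegral_weight_le {n : ℕ} (hn : 1 ≤ n) {δ : ℝ}
    (hδ : δ = 2 / (((n : ℝ) + 1) * (n + 2))) :
    ∃ C : ℝ≥0, ∀ (f : ℕ → ℝ → ℝ) (I : Set ℝ), IsDerivChain n f I → ∀ s ∈ I,
      ∀ E ⊆ increasingRegion n I s,
        (∫⁻ v in E, ENNReal.ofReal (Real.exp (δ * ∑ i, Real.log (f (n + 1) (v i))))) ^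
            (((n : ℝ) + 3) / 2) * ENNReal.ofReal (Real.exp (δ * Real.log (f (n + 1) s))) ≤
          C * ∫⁻ v in E, ENNReal.ofReal (curveJacobian n f (Fin.cons s v)).det := by
  obtain ⟨C, hC⟩ := lintegral_weight_sublevel_le hn hδ
  have hr : (0 : ℝ) < ((n : ℝ) + 1) / 2 := by positivity
  obtain ⟨C', hC'⟩ := exists_rpow_le_of_forall_le_add hr C
  refine ⟨C', fun f I hf s hs E hE => ?_⟩
  set ℓ := Real.log (f (n + 1) s)
  set X := ∫⁻ v in E, ENNReal.ofReal (curveJacobian n f (Fin.cons s v)).det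
  have hJm : Measurable fun v : Fin n → ℝ =>
      ENNReal.ofReal (curveJacobian n f (Fin.cons s v)).det :=
    ((measurable_det_curveJacobian (hf.measurable 1 (by omega))).comp
      (measurable_cons s)).ennreal_ofReal
  have h1 := hC' (∫⁻ v in E, ENNReal.ofReal (Real.exp (δ * ∑ i, Real.log (f (n + 1) (v i)))))
    (ENNReal.ofReal (Real.exp (-(δ * ℓ))) * X) (fun x hx => by
      -- At this level the sublevel bound becomes `C x`; off the sublevel set the weight is at most
      -- `e^(-L)` times the Jacobian, with `e^(-L) = x^(-(n+1)/2) e^(-δℓ)`.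
      set L := δ * ℓ + ((n : ℝ) + 1) / 2 * Real.log x with hL
      set S := {v | v ∈ increasingRegion n I s ∧ Real.log (curveJacobian n f (Fin.cons s v)).det ≤
        L + δ * ∑ i, Real.log (f (n + 1) (v i))} with hS
      have hx1 : Real.exp (2 / (n + 1) * (L - δ * ℓ)) = x := by
        have : 2 / (n + 1) * (L - δ * ℓ) = Real.log x := by
          rw [hL]
          field_simp
          ring
        rw [this, Real.exp_log hx]
      have hx2 : Real.exp (-L) = x ^ (-(((n : ℝ) + 1) / 2)) * Real.exp (-(δ * ℓ)) := by
        rw [Real.rpow_def_of_pos hx, ← Real.exp_add, hL]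
        congr 1
        ring
      have h2 := hC f I hf s hs L
      rw [hx1] at h2
      have hsub : E ⊆ S ∪ (E \ S) := by
        rw [Set.union_sdiff_self]
        exact Set.subset_union_right
      refine (lintegral_mono_set hsub).trans ((lintegral_union_le _ _ _).trans ?_)
      refine add_le_add h2 ?_
      rw [← mul_assoc, ← ENNReal.ofReal_mul (by positivity), ← hx2, ← lintegral_const_mul _ hJm]
      refine (setLIntegral_mono (hJm.const_mul _) fun v hv => ?_).trans
        (lintegral_mono_set Set.sdiff_subset)
      have hreg := hE hv.1
      have hJ := det_curveJacobian_pos hf hreg.1 hreg.2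
      have h3 : L + δ * ∑ i, Real.log (f (n + 1) (v i)) <
          Real.log (curveJacobian n f (Fin.cons s v)).det := by
        by_contra hcon
        exact hv.2 ⟨hreg, not_lt.1 hcon⟩
      rw [← ENNReal.ofReal_mul (Real.exp_pos _).le]
      refine ENNReal.ofReal_le_ofReal ?_
      rw [← Real.exp_log hJ, ← Real.exp_add, Real.exp_le_exp]
      linarith)
  have h4 : ((n : ℝ) + 1) / 2 + 1 = ((n : ℝ) + 3) / 2 := by ring
  rw [h4] at h1
  calc _ ≤ C' * (ENNReal.ofReal (Real.exp (-(δ * ℓ))) * X) *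
        ENNReal.ofReal (Real.exp (δ * ℓ)) := by gcongr
    _ = C' * X * (ENNReal.ofReal (Real.exp (-(δ * ℓ))) * ENNReal.ofReal (Real.exp (δ * ℓ))) := by
        ring
    _ = C' * X := by
        rw [← ENNReal.ofReal_mul (Real.exp_pos _).le, ← Real.exp_add]
        simp

/-! ### Symmetrisation -/

theorem volume_eval_eq_const {n : ℕ} (i : Fin n) (x : ℝ) :
    volume {v : Fin n → ℝ | v i = x} = 0 := by
  rw [volume_pi]
  exact Measure.pi_hyperplane (α := fun _ : Fin n => ℝ) (fun _ => volume) i x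

theorem volume_eval_eq_eval {n : ℕ} {i j : Fin n} (hij : i ≠ j) :
    volume {v : Fin n → ℝ | v i = v j} = 0 := by
  have h1 : {v : Fin n → ℝ | v i = v j} = (LinearMap.ker
      (LinearMap.proj (R := ℝ) (φ := fun _ : Fin n => ℝ) i - LinearMap.proj j) :
      Submodule ℝ (Fin n → ℝ)) := by
    ext v
    simp [sub_eq_zero]
  rw [h1]
  refine Measure.addHaar_submodule _ _ fun h => ?_
  have h2 : (Pi.single i 1 : Fin n → ℝ) ∈ (LinearMap.ker
      (LinearMap.proj (R := ℝ) (φ := fun _ : Fin n => ℝ) i - LinearMap.proj j)) := by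
    rw [h]
    trivial
  simp [hij.symm] at h2

theorem measurePreserving_comp_perm {n : ℕ} (σ : Equiv.Perm (Fin n)) :
    ∃ e : (Fin n → ℝ) ≃ᵐ (Fin n → ℝ), MeasurePreserving e ∧ ∀ v, e v = v ∘ σ := by
  refine ⟨MeasurableEquiv.piCongrLeft (fun _ => ℝ) σ.symm,
    volume_measurePreserving_piCongrLeft (fun _ : Fin n => ℝ) σ.symm, fun v => ?_⟩
  funext i
  obtain ⟨j, rfl⟩ := σ.symm.surjective i
  rw [MeasurableEquiv.piCongrLeft_apply_apply]
  simp

/-- Reduction of the integral of a symmetric function to increasing tuples. -/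
theorem setLIntegral_le_factorial_mul {n : ℕ} {I : Set ℝ} {s : ℝ} (hs : s ∈ I)
    {G : (Fin n → ℝ) → ℝ≥0∞} (hG : ∀ (σ : Equiv.Perm (Fin n)) (v : Fin n → ℝ), G (v ∘ σ) = G v) :
    ∫⁻ v in {v : Fin n → ℝ | ∀ i, s ≤ v i ∧ v i ∈ I}, G v ≤
      (Nat.factorial n : ℝ≥0∞) * ∫⁻ v in increasingRegion n I s, G v := by
  -- Off this null set the coordinates are distinct and differ from `s`, so sorting lands in
  -- `increasingRegion`.
  set N : Set (Fin n → ℝ) := (⋃ i, {v | v i = s}) ∪ ⋃ i, ⋃ j, {v | i ≠ j ∧ v i = v j} with hN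
  have hN0 : volume N = 0 := by
    rw [hN, measure_union_null_iff, measure_iUnion_null_iff, measure_iUnion_null_iff]
    refine ⟨fun i => volume_eval_eq_const i s, fun i => measure_iUnion_null_iff.2 fun j => ?_⟩
    by_cases hij : i = j
    · simp [hij]
    · simpa [hij] using volume_eval_eq_eval hij
  have hsub : {v : Fin n → ℝ | ∀ i, s ≤ v i ∧ v i ∈ I} ⊆
      N ∪ ⋃ σ : Equiv.Perm (Fin n), {v | v ∘ σ ∈ increasingRegion n I s} := by
    intro v hv
    by_cases hvN : v ∈ N
    · exact Or.inl hvN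
    · right
      simp only [hN, Set.mem_union, Set.mem_iUnion, Set.mem_ofPred_eq, not_or, not_exists,
        not_and] at hvN
      have hinj : Function.Injective v := fun i j hij => by
        by_contra hne
        exact hvN.2 i j hne hij
      refine Set.mem_iUnion.2 ⟨Tuple.sort v, ?_, ?_⟩
      · have hmono : StrictMono (v ∘ Tuple.sort v) :=
          (Tuple.monotone_sort v).strictMono_of_injective (hinj.comp (Tuple.sort v).injective)
        intro i j hij
        induction j using Fin.cases with
        | zero => exact absurd hij (Fin.not_lt_zero i)
        | succ j =>
          induction i using Fin.cases with
          | zero =>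
            simp only [Fin.cons_zero, Fin.cons_succ]
            exact lt_of_le_of_ne (hv _).1 (Ne.symm (hvN.1 _))
          | succ i =>
            simp only [Fin.cons_succ]
            exact hmono (Fin.succ_lt_succ_iff.1 hij)
      · intro i
        induction i using Fin.cases with
        | zero => simpa using hs
        | succ i => simpa using (hv _).2
  refine (lintegral_mono_set hsub).trans ((lintegral_union_le _ _ _).trans ?_)
  rw [setLIntegral_measure_zero _ _ hN0, zero_add]
  refine (lintegral_iUnion_le _ _).trans ?_
  have h1 : ∀ σ : Equiv.Perm (Fin n), ∫⁻ v in {v | v ∘ σ ∈ increasingRegion n I s}, G v =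
      ∫⁻ v in increasingRegion n I s, G v := by
    intro σ
    obtain ⟨e, he, hev⟩ := measurePreserving_comp_perm σ
    have h2 := he.setLIntegral_comp_preimage_emb e.measurableEmbedding G (increasingRegion n I s)
    have h3 : e ⁻¹' increasingRegion n I s = {v | v ∘ σ ∈ increasingRegion n I s} := by
      ext v
      rw [Set.mem_preimage, hev]
      rfl
    simpa only [hev, hG, h3] using h2
  simp only [h1]
  rw [tsum_fintype, Finset.sum_const, Finset.card_univ, Fintype.card_perm, Fintype.card_fin,
    nsmul_eq_mul]

/-! ### Integration over the first coordinate and simple curves -/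

/-- The main estimate, for a chain of derivatives. -/
theorem lintegral_rpow_lintegral_le {n : ℕ} (hn : 1 ≤ n) {δ : ℝ}
    (hδ : δ = 2 / (((n : ℝ) + 1) * (n + 2))) :
    ∃ C : ℝ≥0, ∀ (f : ℕ → ℝ → ℝ) (I : Set ℝ), IsDerivChain n f I →
      ∀ F : Set (Fin (n + 1) → ℝ), MeasurableSet F →
        ∫⁻ s in I, (∫⁻ v in {v : Fin n → ℝ | ∀ i, s ≤ v i ∧ v i ∈ I},
            F.indicator (fun _ => (1 : ℝ≥0∞)) (curveDeriv n f 0 s + ∑ i, curveDeriv n f 0 (v i)) *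
              ENNReal.ofReal ((∏ i, f (n + 1) (v i)) ^ δ)) ^ (((n : ℝ) + 3) / 2) *
            ENNReal.ofReal (f (n + 1) s ^ δ) ≤ C * volume F := by
  obtain ⟨C, hC⟩ := rpow_lintegral_weight_le hn hδ
  have hq : (0 : ℝ) ≤ ((n : ℝ) + 3) / 2 := by positivity
  set A : ℝ≥0 := (Nat.factorial n : ℝ≥0) ^ (((n : ℝ) + 3) / 2) * C with hA
  refine ⟨A, fun f I hf F hF => ?_⟩
  set Δ : Set (Fin (n + 1) → ℝ) := {t | StrictMono t ∧ ∀ i, t i ∈ I} with hΔ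
  have hΔm : MeasurableSet Δ := measurableSet_strictMono (n + 1) hf.isOpen.measurableSet
  have hγ : Measurable (curveDeriv n f 0) := measurable_curveDeriv (hf.measurable 0 (by omega))
  have hΓ : Measurable fun t : Fin (n + 1) → ℝ => ∑ j, curveDeriv n f 0 (t j) :=
    Finset.measurable_fun_sum _ fun j _ => hγ.comp (measurable_pi_apply j)
  have hJm := measurable_det_curveJacobian (n := n) (hf.measurable 1 (by omega))
  have hI := hf.isOpen.measurableSet
  -- Extension by zero to the whole space lets Tonelli reassemble the fibres.
  set H : (Fin (n + 1) → ℝ) → ℝ≥0∞ := Δ.indicator fun t =>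
    ENNReal.ofReal (curveJacobian n f t).det *
      F.indicator (fun _ => (1 : ℝ≥0∞)) (∑ j, curveDeriv n f 0 (t j)) with hH
  have hHm : Measurable H := (hJm.ennreal_ofReal.mul
    ((measurable_const.indicator hF).comp hΓ)).indicator hΔm
  have hlast : ∫⁻ t, H t ≤ volume F := by
    rw [hH, lintegral_indicator hΔm]
    exact lintegral_det_curveJacobian_le hf hF
  have key : ∀ s ∈ I, (∫⁻ v in {v : Fin n → ℝ | ∀ i, s ≤ v i ∧ v i ∈ I},
      F.indicator (fun _ => (1 : ℝ≥0∞)) (curveDeriv n f 0 s + ∑ i, curveDeriv n f 0 (v i)) *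
        ENNReal.ofReal ((∏ i, f (n + 1) (v i)) ^ δ)) ^ (((n : ℝ) + 3) / 2) *
      ENNReal.ofReal (f (n + 1) s ^ δ) ≤ A * ∫⁻ v : Fin n → ℝ, H (Fin.cons s v) := by
    intro s hs
    set E : Set (Fin n → ℝ) := increasingRegion n I s ∩
      {v | curveDeriv n f 0 s + ∑ i, curveDeriv n f 0 (v i) ∈ F} with hE
    have hRm : MeasurableSet (increasingRegion n I s) := measurable_cons s hΔm
    have hFm : MeasurableSet {v : Fin n → ℝ |
        curveDeriv n f 0 s + ∑ i, curveDeriv n f 0 (v i) ∈ F} := by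
      refine (measurable_const.add ?_ : Measurable fun v : Fin n → ℝ =>
        curveDeriv n f 0 s + ∑ i, curveDeriv n f 0 (v i)) hF
      exact Finset.measurable_fun_sum _ fun j _ => hγ.comp (measurable_pi_apply j)
    have h1 := setLIntegral_le_factorial_mul (n := n) hs (G := fun v =>
      F.indicator (fun _ => (1 : ℝ≥0∞)) (curveDeriv n f 0 s + ∑ i, curveDeriv n f 0 (v i)) *
        ENNReal.ofReal ((∏ i, f (n + 1) (v i)) ^ δ)) (fun σ v => by
          have h2 : ∑ i, curveDeriv n f 0 ((v ∘ σ) i) = ∑ i, curveDeriv n f 0 (v i) :=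
            Equiv.sum_comp σ fun i => curveDeriv n f 0 (v i)
          have h3 : ∏ i, f (n + 1) ((v ∘ σ) i) = ∏ i, f (n + 1) (v i) :=
            Equiv.prod_comp σ fun i => f (n + 1) (v i)
          simp only [h2, h3])
    have h2 : ∫⁻ v in increasingRegion n I s, F.indicator (fun _ => (1 : ℝ≥0∞))
        (curveDeriv n f 0 s + ∑ i, curveDeriv n f 0 (v i)) *
          ENNReal.ofReal ((∏ i, f (n + 1) (v i)) ^ δ) =
        ∫⁻ v in E, ENNReal.ofReal (Real.exp (δ * ∑ i, Real.log (f (n + 1) (v i)))) := by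
      rw [hE, Set.inter_comm, ← setLIntegral_indicator hFm]
      refine setLIntegral_congr_fun hRm fun v hv => ?_
      have hpos : ∀ i, 0 < f (n + 1) (v i) := fun i => by
        have := hv.2 i.succ
        rw [Fin.cons_succ] at this
        exact hf.pos _ this
      have h3 : (∏ i, f (n + 1) (v i)) ^ δ =
          Real.exp (δ * ∑ i, Real.log (f (n + 1) (v i))) := by
        rw [Real.rpow_def_of_pos (Finset.prod_pos fun i _ => hpos i),
          Real.log_prod fun i _ => (hpos i).ne', mul_comm]
      by_cases hvF : curveDeriv n f 0 s + ∑ i, curveDeriv n f 0 (v i) ∈ F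
      · simp only [h3]
        rw [Set.indicator_of_mem hvF, Set.indicator_of_mem (s := {v : Fin n → ℝ |
          curveDeriv n f 0 s + ∑ i, curveDeriv n f 0 (v i) ∈ F}) hvF, one_mul]
      · simp only [h3]
        rw [Set.indicator_of_notMem hvF, Set.indicator_of_notMem (s := {v : Fin n → ℝ |
          curveDeriv n f 0 s + ∑ i, curveDeriv n f 0 (v i) ∈ F}) hvF, zero_mul]
    have h3 : ∫⁻ v in E, ENNReal.ofReal (curveJacobian n f (Fin.cons s v)).det =
        ∫⁻ v : Fin n → ℝ, H (Fin.cons s v) := by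
      rw [← lintegral_indicator (hRm.inter hFm)]
      refine lintegral_congr fun v => ?_
      have hsum : ∑ j, curveDeriv n f 0 ((Fin.cons s v : Fin (n + 1) → ℝ) j) =
          curveDeriv n f 0 s + ∑ i, curveDeriv n f 0 (v i) := by
        simp only [Fin.sum_univ_succ, Fin.cons_zero, Fin.cons_succ]
      by_cases hv : v ∈ increasingRegion n I s
      · have hv' : (Fin.cons s v : Fin (n + 1) → ℝ) ∈ Δ := hv
        rw [hH, Set.indicator_of_mem hv', hsum]
        by_cases hvF : curveDeriv n f 0 s + ∑ i, curveDeriv n f 0 (v i) ∈ F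
        · rw [Set.indicator_of_mem hvF, Set.indicator_of_mem (Set.mem_inter hv hvF), mul_one]
        · rw [Set.indicator_of_notMem hvF, Set.indicator_of_notMem fun h => hvF h.2, mul_zero]
      · have hv' : (Fin.cons s v : Fin (n + 1) → ℝ) ∉ Δ := hv
        rw [hH, Set.indicator_of_notMem hv', Set.indicator_of_notMem fun h => hv h.1]
    have h4 : f (n + 1) s ^ δ = Real.exp (δ * Real.log (f (n + 1) s)) := by
      rw [Real.rpow_def_of_pos (hf.pos s hs), mul_comm]
    have h5 := hC f I hf s hs E Set.inter_subset_left
    rw [h3] at h5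
    rw [h2] at h1
    rw [h4]
    calc _ ≤ ((Nat.factorial n : ℝ≥0∞) *
          ∫⁻ v in E, ENNReal.ofReal (Real.exp (δ * ∑ i, Real.log (f (n + 1) (v i))))) ^
            (((n : ℝ) + 3) / 2) * ENNReal.ofReal (Real.exp (δ * Real.log (f (n + 1) s))) := by
          gcongr
      _ ≤ (Nat.factorial n : ℝ≥0∞) ^ (((n : ℝ) + 3) / 2) *
          (C * ∫⁻ v : Fin n → ℝ, H (Fin.cons s v)) := by
          rw [ENNReal.mul_rpow_of_nonneg _ _ hq, mul_assoc]
          gcongr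
      _ = A * ∫⁻ v : Fin n → ℝ, H (Fin.cons s v) := by
          rw [hA, ← mul_assoc, ENNReal.coe_mul, ENNReal.coe_rpow_of_nonneg _ hq,
            ENNReal.coe_natCast]
  calc _ ≤ ∫⁻ s in I, A * ∫⁻ v : Fin n → ℝ, H (Fin.cons s v) := setLIntegral_mono' hI key
    _ ≤ ∫⁻ s, A * ∫⁻ v : Fin n → ℝ, H (Fin.cons s v) := setLIntegral_le_lintegral _ _
    _ = A * ∫⁻ t, H t := by
        rw [lintegral_const_mul' _ _ ENNReal.coe_ne_top, lintegral_pi_fin_succ hHm]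
    _ ≤ A * volume F := by gcongr

theorem isOpen_openInterval (a b : EReal) : IsOpen (openInterval a b) :=
  isOpen_Ioo.preimage continuous_coe_real_ereal

theorem ordConnected_openInterval (a b : EReal) : (openInterval a b).OrdConnected :=
  ⟨fun _ hx _ hy _ hz => ⟨hx.1.trans_le (EReal.coe_le_coe_iff.2 hz.1),
    (EReal.coe_le_coe_iff.2 hz.2).trans_lt hy.2⟩⟩

/-- The indicator discards uncontrolled values outside the interval, which gives global
measurability without affecting derivatives inside. Strict monotonicity of the weight comes from
`φ^(d+1) > 0`. -/
theorem IsSimpleOn.isDerivChain {n : ℕ} {φ : ℝ → ℝ} {a b : EReal} (h : IsSimpleOn (n + 1) φ a b) :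
    IsDerivChain n (fun k => (openInterval a b).indicator (iteratedDeriv k φ))
      (openInterval a b) := by
  have hI := isOpen_openInterval a b
  have hd : ∀ k ≤ n + 2, ∀ x ∈ openInterval a b,
      HasDerivAt (iteratedDeriv k φ) (iteratedDeriv (k + 1) φ x) x := by
    intro k hk x hx
    have h1 := (h.contDiffOn.differentiableOn_iteratedDerivWithin (m := k)
      (by exact_mod_cast (by omega : k < n + 1 + 2)) hI.uniqueDiffOn).differentiableAt
      (hI.mem_nhds hx)
    have h2 : DifferentiableAt ℝ (iteratedDeriv k φ) x :=
      h1.congr_of_eventuallyEq (Filter.eventuallyEq_of_mem (hI.mem_nhds hx)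
        fun y hy => (iteratedDerivWithin_of_isOpen hI hy).symm)
    rw [iteratedDeriv_succ]
    exact h2.hasDerivAt
  have hd' : ∀ k ≤ n + 2, ∀ x ∈ openInterval a b,
      HasDerivAt ((openInterval a b).indicator (iteratedDeriv k φ))
        ((openInterval a b).indicator (iteratedDeriv (k + 1) φ) x) x := by
    intro k hk x hx
    rw [Set.indicator_of_mem hx]
    exact (hd k hk x hx).congr_of_eventuallyEq
      (Filter.eventuallyEq_of_mem (hI.mem_nhds hx) fun y hy => Set.indicator_of_mem hy _)
  have hcont : ∀ k ≤ n + 2, ContinuousOn ((openInterval a b).indicator (iteratedDeriv k φ))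
      (openInterval a b) := fun k hk x hx => (hd' k hk x hx).continuousAt.continuousWithinAt
  refine ⟨hI, ordConnected_openInterval a b, fun k hk x hx => hd' k (by omega) x hx,
    fun x hx => ?_, hcont _ (by omega), ?_, fun k hk => ?_⟩
  · rw [Set.indicator_of_mem hx]
    exact h.iteratedDeriv_pos _ (by omega) x hx
  · refine strictMonoOn_of_deriv_pos (ordConnected_openInterval a b).convex (hcont _ (by omega))
      fun x hx => ?_
    have hx' := interior_subset hx
    rw [(hd' (n + 1) (by omega) x hx').deriv, Set.indicator_of_mem hx']
    exact h.iteratedDeriv_pos _ (by omega) x hx'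
  · have h1 : ContinuousOn (iteratedDeriv k φ) (openInterval a b) :=
      fun x hx => (hd k (by omega) x hx).continuousAt.continuousWithinAt
    classical
    rw [← Set.piecewise_eq_indicator]
    exact h1.measurable_piecewise continuousOn_const hI.measurableSet

theorem theorem1p2 (d : ℕ) (hd : 2 ≤ d) :
    ∃ C : ℝ≥0, ∀ (a b : EReal), a < b → ∀ φ : ℝ → ℝ, IsSimpleOn d φ a b →
      ∀ F : Set (Fin d → ℝ), MeasurableSet F →
        ∫⁻ t₁ in openInterval a b,
            innerIntegral d φ b F t₁ ^ (((d : ℝ) + 2) / 2) *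
              ENNReal.ofReal (curveWeight d φ t₁ ^ (2 / ((d : ℝ) ^ 2 + (d : ℝ))))
          ≤ (C : ℝ≥0∞) * volume F := by
  obtain ⟨n, rfl⟩ : ∃ n, d = n + 1 := ⟨d - 1, by omega⟩
  obtain ⟨C, hC⟩ := lintegral_rpow_lintegral_le (n := n) (by omega) rfl
  refine ⟨C, fun a b _ φ hφ F hF => le_trans (le_of_eq ?_) (hC _ _ hφ.isDerivChain F hF)⟩
  refine setLIntegral_congr_fun (isOpen_openInterval a b).measurableSet fun s hs => ?_
  have he1 : (((n + 1 : ℕ) : ℝ) + 2) / 2 = ((n : ℝ) + 3) / 2 := by push_cast; ring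
  have he2 : 2 / (((n + 1 : ℕ) : ℝ) ^ 2 + ((n + 1 : ℕ) : ℝ)) = 2 / (((n : ℝ) + 1) * (n + 2)) := by
    push_cast
    ring
  have hγ : ∀ x ∈ openInterval a b, simpleCurve (n + 1) φ x = curveDeriv n
      (fun k => (openInterval a b).indicator (iteratedDeriv k φ)) 0 x := fun x hx => by
    funext i
    simp [simpleCurve, curveDeriv, Set.indicator_of_mem hx]
  have hω : ∀ x ∈ openInterval a b, curveWeight (n + 1) φ x =
      (openInterval a b).indicator (iteratedDeriv (n + 1) φ) x := fun x hx => by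
    rw [Set.indicator_of_mem hx, curveWeight]
  -- The lower endpoint imposes nothing new, since `a < s ≤ v i`.
  have hset : {v : Fin n → ℝ | ∀ i, s ≤ v i ∧ v i ∈ openInterval a b} =
      {v : Fin n → ℝ | ∀ i, s ≤ v i ∧ (v i : EReal) < b} := by
    ext v
    refine forall_congr' fun i => and_congr_right fun h => ⟨fun h' => h'.2, fun h' => ⟨?_, h'⟩⟩
    exact hs.1.trans_le (EReal.coe_le_coe_iff.2 h)
  have hmeas : MeasurableSet {v : Fin n → ℝ | ∀ i, s ≤ v i ∧ v i ∈ openInterval a b} := by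
    have h1 : {v : Fin n → ℝ | ∀ i, s ≤ v i ∧ v i ∈ openInterval a b} =
        ⋂ i, (fun v : Fin n → ℝ => v i) ⁻¹' (Set.Ici s ∩ openInterval a b) := by
      ext v
      simp
    rw [h1]
    exact MeasurableSet.iInter fun i => measurable_pi_apply i
      (measurableSet_Ici.inter (isOpen_openInterval a b).measurableSet)
  have hinner : innerIntegral (n + 1) φ b F s =
      ∫⁻ v in {v : Fin n → ℝ | ∀ i, s ≤ v i ∧ v i ∈ openInterval a b},
        F.indicator (fun _ => (1 : ℝ≥0∞)) (curveDeriv n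
            (fun k => (openInterval a b).indicator (iteratedDeriv k φ)) 0 s +
          ∑ i, curveDeriv n
            (fun k => (openInterval a b).indicator (iteratedDeriv k φ)) 0 (v i)) *
          ENNReal.ofReal ((∏ i, (openInterval a b).indicator (iteratedDeriv (n + 1) φ) (v i)) ^
            (2 / (((n : ℝ) + 1) * (n + 2)))) := by
    rw [← he2]
    have h1 : innerIntegral (n + 1) φ b F s =
        ∫⁻ v in {v : Fin n → ℝ | ∀ i, s ≤ v i ∧ v i ∈ openInterval a b},
          F.indicator (fun _ => (1 : ℝ≥0∞))
            (simpleCurve (n + 1) φ s + ∑ i, simpleCurve (n + 1) φ (v i)) *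
          ENNReal.ofReal ((∏ i, curveWeight (n + 1) φ (v i)) ^
            (2 / (((n + 1 : ℕ) : ℝ) ^ 2 + ((n + 1 : ℕ) : ℝ)))) := by
      rw [hset]
      rfl
    refine h1.trans (setLIntegral_congr_fun hmeas fun v hv => ?_)
    simp only [hγ s hs]
    rw [Finset.sum_congr rfl fun i _ => hγ (v i) (hv i).2,
      Finset.prod_congr rfl fun i _ => hω (v i) (hv i).2]
  simp only [hinner, hω s hs, he1, he2]
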